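/- Let $\mathcal C$ be a finite set of finite connected graphs, each of them \emph{solid}, i.e. every induced 2-connected subgraph (at least three vertices, connected, and connected after deleting any one vertex) is complete. A graph omits $\mathcal C$ if none of its subgraphs, induced or not, is isomorphic to a member of $\mathcal C$; $\mathcal G_{\mathcal C}$ is the class of countable graphs omitting $\mathcal C$. Let $\mathcal E_{\mathcal C}$ be the class of all $G\in\mathcal G_{\mathcal C}$ that are existentially complete: whenever $G$ is an induced subgraph of some $H\in\mathcal G_{\mathcal C}$, every existential first-order statement with parameters from $G$ that is true in $H$ is true in $G$. The type of a finite tuple of vertices of a graph is the set of existential formulas it satisfies. Let $G\in\mathcal E_{\mathcal C}$ be $\aleph_0$-saturated: for every $n$-tuple $\bar a$ in $G$ and every $(n+1)$-tuple $\bar b$ in some $H\in\mathcal E_{\mathcal C}$ whose first $n$ entries have in $H$ the type that $\bar a$ has in $G$, there is a vertex $v$ of $G$ such that $(\bar a,v)$ has in $G$ the type that $\bar b$ has in $H$. For a set $X$ of vertices of $G$ let $\mathrm{acl}(X)$ be the set of vertices $x$ for which there is an existential formula $\varphi(\cdot,\bar a)$ with parameters $\bar a$ in $X$ that holds of $x$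 and of only finitely many vertices of $G$. For a finite (not necessarily induced) subgraph $H$ of $G$ and a set $A$ of vertices of $H$, say that $H$ is \emph{free} over $A$ if there is an infinite sequence of injective graph homomorphisms $f_i:H\to G$ fixing $A$ pointwise with $f_i(H)\cap f_j(H)=A$ (as vertex sets) for all $i\ne j$. Let $\mathrm{cl}(A;H)$ be the union of $A$ with all sets $B$ of vertices of $H$ that are minimal such that $H$ is free over $A\cup B$. For a collection $\mathcal F$ of pairs $(A,H)$, where $H$ is a finite graph and $A$ a set of its vertices, let $\mathrm{cl}(X;\mathcal F)$ be the union of $X$ with all sets $\mathrm{cl}(A;H)$ where $A\subseteq X$, $H$ is a subgraph of $G$ and $(A,H)$ is isomorphic to a pair in $\mathcal F$. Call $\mathcal F$ a \emph{base} for $\mathrm{acl}$ if for all sets $X$ of vertices of $G$: $X=\mathrm{cl}(X;\mathcal F)$ if and only if $X=\mathrm{acl}(X)$. Let $\mathcal F$ be the collection of all pairs $(\{a\},H)$ for which, for some $C\in\mathcal C$, $H$ is a proper subgraph of $C$, $a$ is a vertex of $H$, and $H-\{a\}$ is a connected component of $C-\{a\}$. Then $\mathcal F$ is a base for $\mathrm{acl}$,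 and so is the subcollection of those pairs in which $H$ is an induced subgraph of $C$. In particular, for every set $X$ of vertices of $G$, $$\mathrm{acl}(X)=\bigcup_{a\in X}\mathrm{acl}(\{a\}).$$ -/

import Mathlib

open FirstOrder

universe u

namespace ForbiddenSubgraphs

/-- A finite graph (every finite graph is isomorphic to one on some `Fin n`). -/
structure FinGraph where
  order : ℕ
  graph : SimpleGraph (Fin order)

/-- `G` omits `𝒞`: no (not necessarily induced) subgraph of `G` is isomorphic to a member of `𝒞`. -/
def Omits (𝒞 : Set FinGraph) {V : Type u} (G : SimpleGraph V) : Prop :=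
  ∀ C ∈ 𝒞, C.graph.Free G

/-- `G` is a countable graph omitting `𝒞`. -/
def MemG (𝒞 : Set FinGraph) {V : Type u} (G : SimpleGraph V) : Prop :=
  Countable V ∧ Omits 𝒞 G

/-- Truth of a first-order formula of the language of graphs at a tuple of vertices of `G`. -/
def Sat {V : Type u} (G : SimpleGraph V) {n : ℕ} (φ : Language.graph.Formula (Fin n))
    (a : Fin n → V) : Prop :=
  letI := G.structure
  φ.Realize a

/-- `G`, identified with an induced subgraph of `H` by `f`, is existentially complete in `H`:
every existential statement with parameters from `G` that is true in `H` is true in `G`. -/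
def ExComplete {V W : Type u} {G : SimpleGraph V} {H : SimpleGraph W} (f : G ↪g H) : Prop :=
  ∀ (n : ℕ) (φ : Language.graph.Formula (Fin n)) (a : Fin n → V),
    φ.IsExistential → Sat H φ (f ∘ a) → Sat G φ a

/-- `G` is existentially complete for the class of countable graphs omitting `𝒞`. -/
def MemE (𝒞 : Set FinGraph) {V : Type u} (G : SimpleGraph V) : Prop :=
  MemG 𝒞 G ∧
    ∀ (W : Type u) (H : SimpleGraph W), MemG 𝒞 H → ∀ f : G ↪g H, ExComplete f

/-- The existential type of a tuple. -/
def exType {V : Type u} (G : SimpleGraph V) {n : ℕ} (a : Fin n → V) :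
    Set (Language.graph.Formula (Fin n)) :=
  {φ | φ.IsExistential ∧ Sat G φ a}

/-- `ℵ₀`-saturation of `G` among existentially complete graphs: every existential `(n+1)`-type
realized in some existentially complete graph, whose restriction to the first `n` variables is
the type of `a` in `G`, is realized in `G` by a tuple `(a, v)`. -/
def Saturated (𝒞 : Set FinGraph) {V : Type u} (G : SimpleGraph V) : Prop :=
  ∀ (n : ℕ) (a : Fin n → V) (W : Type u) (H : SimpleGraph W), MemE 𝒞 H →
    ∀ b : Fin (n + 1) → W, exType H (b ∘ Fin.castSucc) = exType G a →
      ∃ v : V, exType G (Fin.snoc a v : Fin (n + 1) → V) = exType H b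

/-- Algebraic closure: the vertices lying in a finite set defined by an existential formula with
parameters from `A`. -/
def acl {V : Type u} (G : SimpleGraph V) (A : Set V) : Set V :=
  {x | ∃ (n : ℕ) (φ : Language.graph.Formula (Fin (n + 1))) (a : Fin n → V),
    φ.IsExistential ∧ (∀ i, a i ∈ A) ∧
    {y | Sat G φ (Fin.snoc a y : Fin (n + 1) → V)}.Finite ∧
    Sat G φ (Fin.snoc a x : Fin (n + 1) → V)}

/-- For a subgraph `H` of `G` and `A ⊆ H`: `H` is free over `A` if there is an infinite family
of copies of `H` in `G` over `A`, any two of which intersect exactly in `A`. Copies are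
not necessarily induced. In particular `H` is free over its whole vertex set. -/
def FreeOver {V : Type u} (G : SimpleGraph V) (A : Set V) (H : G.Subgraph) : Prop :=
  ∃ f : ℕ → H.coe.Copy G,
    (∀ i, ∀ x : H.verts, (x : V) ∈ A → f i x = x) ∧
    ∀ i j, i ≠ j → Set.range (f i) ∩ Set.range (f j) = A

/-- `cl(A; H)`: the union of `A` with all `B ⊆ H` minimal such that `H` is free over `A ∪ B`. -/
def cl {V : Type u} (G : SimpleGraph V) (A : Set V) (H : G.Subgraph) : Set V :=
  A ∪ ⋃₀ {B | Minimal (fun B' => B' ⊆ H.verts ∧ FreeOver G (A ∪ B') H) B}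

/-- A pair `(A, H)` with `H` a finite graph and `A` a set of vertices of `H`. -/
structure GraphPair where
  order : ℕ
  graph : SimpleGraph (Fin order)
  base : Set (Fin order)

/-- For a subgraph `H` of `G`, the pair `(A, H)` is isomorphic to the pair `p`. -/
def IsoPair {V : Type u} {G : SimpleGraph V} (A : Set V) (H : G.Subgraph) (p : GraphPair) : Prop :=
  A ⊆ H.verts ∧ ∃ e : H.coe ≃g p.graph, ∀ x : H.verts, (x : V) ∈ A ↔ e x ∈ p.base

/-- `cl(X; F)`: the union of `X` with all `cl(A; H)` for which `A ⊆ X`, `H` is a subgraph of `G`,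
and `(A, H)` is isomorphic to a pair in `F`. -/
def clFam {V : Type u} (G : SimpleGraph V) (F : Set GraphPair) (X : Set V) : Set V :=
  X ∪ {y | ∃ (A : Set V) (H : G.Subgraph), A ⊆ X ∧ (∃ p ∈ F, IsoPair A H p) ∧ y ∈ cl G A H}

/-- `F` is a base for `acl` in `G`. -/
def IsBase {V : Type u} (G : SimpleGraph V) (F : Set GraphPair) : Prop :=
  ∀ X : Set V, X = clFam G F X ↔ X = acl G X

/-- A graph with at least three vertices that is connected and stays so on deletion of any
one vertex. -/
def TwoConnected {V : Type u} (G : SimpleGraph V) : Prop :=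
  3 ≤ ENat.card V ∧ G.Connected ∧ ∀ v : V, (G.induce {v}ᶜ).Connected

/-- Every 2-connected induced subgraph is complete. -/
def Solid {V : Type u} (H : SimpleGraph V) : Prop :=
  ∀ S : Set V, TwoConnected (H.induce S) → H.induce S = ⊤

/-- `a` is a vertex of the proper subgraph `H` of `C`, and `H - {a}` is a connected component
of `C - {a}`. -/
def IsBranch {V : Type u} (C : SimpleGraph V) (a : V) (H : C.Subgraph) : Prop :=
  H ≠ ⊤ ∧ a ∈ H.verts ∧
    ∃ K : (C.induce {a}ᶜ).ConnectedComponent,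
      H.deleteVerts {a} = (⊤ : C.Subgraph).induce (Subtype.val '' K.supp)

/-- The pairs `({a}, H)` for which `H` is a proper subgraph of some `C ∈ 𝒞`, `a ∈ H`, and
`H - {a}` is a connected component of `C - {a}`. -/
def branchPairs (𝒞 : Set FinGraph) : Set GraphPair :=
  {p | ∃ C ∈ 𝒞, ∃ (a : Fin C.order) (H : C.graph.Subgraph),
    IsBranch C.graph a H ∧ IsoPair {a} H p}

/-- The pairs `({a}, H)` as in `branchPairs` in which `H` is moreover an induced subgraph of
`C`. -/
def inducedBranchPairs (𝒞 : Set FinGraph) : Set GraphPair :=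
  {p | ∃ C ∈ 𝒞, ∃ (a : Fin C.order) (H : C.graph.Subgraph),
    IsBranch C.graph a H ∧ H.IsInduced ∧ IsoPair {a} H p}

end ForbiddenSubgraphs

namespace ForbiddenSubgraphs

/-! ### Existential predicates, described by patterns of finitely many witnesses -/

/-! Everything turns on the free amalgam `double G X` of two copies of `G` over `X`: the set `X` is
algebraically closed exactly when this amalgam still omits `𝒞`. If the amalgam omits `𝒞`, an
algebraic vertex outside `X` would have a second copy there, and existential completeness would
reflect one solution too many into `G` (`acl_subset_of_omits_double`). Conversely, let `X` be
algebraically closed. By a version of Neumann's lemma (`exists_mem_avoiding`), the part of a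
forbidden graph lying in the second copy outside `X` can be replaced by vertices of `G` that avoid
the rest, so a forbidden subgraph of the amalgam would give one in `G`
(`omits_double_of_acl_subset`).

For algebraically closed `X`, a finite subgraph free over `A ∪ B` can be put in the second copy and
reflected back, which frees it over `A ∪ (B ∩ X)`. Minimal sets `B` therefore lie in `X`, and `X` is
closed under every family of finite pairs (`cl_subset_of_acl_subset`).

Solidity serves the other direction. In a solid graph a vertex and its neighbours in one branch form
a clique, and a clique of the amalgam lies within one copy. Closure under the induced branch pairs
supplies fresh copies of proper branches, so the branches of a putative forbidden subgraph can be
moved one after another into a single copy of `G` (`exists_move`, `free_double`). Hence the amalgam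
omits `𝒞` and `X` is algebraically closed.

The base pairs have one-point bases. As `acl` is idempotent, the union of the closures of points is
closed under these pairs, hence algebraically closed. Idempotence is not formal for existential
formulas; it rests on the maximality of existential types in existentially complete graphs, obtained
from an ultrapower (`MemE.exPred_of_forall_imp`). -/

/-- Two families of vertices have the same equalities and the same adjacencies. -/
structure SamePattern {α V W : Type*} (G : SimpleGraph V) (v : α → V)
    (H : SimpleGraph W) (w : α → W) : Prop where
  eq_iff : ∀ i j, v i = v j ↔ w i = w j
  adj_iff : ∀ i j, G.Adj (v i) (v j) ↔ H.Adj (w i) (w j)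

namespace SamePattern

variable {α β V W : Type*} {G : SimpleGraph V} {H : SimpleGraph W} {v : α → V} {w : α → W}

theorem comp (h : SamePattern G v H w) (g : β → α) : SamePattern G (v ∘ g) H (w ∘ g) :=
  ⟨fun i j => h.eq_iff (g i) (g j), fun i j => h.adj_iff (g i) (g j)⟩

theorem of_embedding (f : G ↪g H) (v : α → V) : SamePattern G v H (f ∘ v) :=
  ⟨fun i j => by simp, fun i j => by simp⟩

end SamePattern

/-- A predicate on families of vertices of graphs that is an existential condition: it is
witnessed by the pattern formed with finitely many further vertices. -/
def ExPred {α : Type*} (P : ∀ V : Type u, SimpleGraph V → (α → V) → Prop) : Prop :=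
  ∃ β : Type, Finite β ∧ ∀ V (G : SimpleGraph V) v, P V G v → ∃ w : β → V,
    ∀ W (H : SimpleGraph W) v' w',
      SamePattern G (Sum.elim v w) H (Sum.elim v' w') → P W H v'

namespace ExPred

variable {α β : Type*}

theorem of_pattern {P : ∀ V : Type u, SimpleGraph V → (α → V) → Prop}
    (h : ∀ V (G : SimpleGraph V) v W (H : SimpleGraph W) w,
      SamePattern G v H w → P V G v → P W H w) : ExPred P :=
  ⟨Empty, inferInstance, fun V G v hv => ⟨Empty.elim, fun W H v' _ hp =>
    h V G v W H v' (hp.comp Sum.inl) hv⟩⟩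

theorem comp {P : ∀ V : Type u, SimpleGraph V → (α → V) → Prop} (hP : ExPred P) (g : α → β) :
    ExPred (fun V G (v : β → V) => P V G (v ∘ g)) := by
  obtain ⟨γ, hγ, h⟩ := hP
  refine ⟨γ, hγ, fun V G v hv => ?_⟩
  obtain ⟨w, hw⟩ := h V G _ hv
  refine ⟨w, fun W H v' w' hp => hw W H _ w' ?_⟩
  have := hp.comp (Sum.map g id)
  simpa [Sum.elim_comp_map] using this

theorem forall_finite {ι : Type} [Finite ι]
    {P : ι → ∀ V : Type u, SimpleGraph V → (α → V) → Prop} (hP : ∀ i, ExPred (P i)) :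
    ExPred (fun V G v => ∀ i, P i V G v) := by
  choose γ hγ h using hP
  refine ⟨Σ i, γ i, inferInstance, fun V G v hv => ?_⟩
  choose w hw using fun i => h i V G v (hv i)
  refine ⟨fun x => w x.1 x.2, fun W H v' w' hp i => hw i W H v' (fun x => w' ⟨i, x⟩) ?_⟩
  have := hp.comp (Sum.map id (Sigma.mk i))
  rwa [Sum.elim_comp_map, Sum.elim_comp_map] at this

theorem and {P Q : ∀ V : Type u, SimpleGraph V → (α → V) → Prop} (hP : ExPred P)
    (hQ : ExPred Q) : ExPred (fun V G v => P V G v ∧ Q V G v) := by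
  have := forall_finite (ι := Bool) (P := fun b => bif b then P else Q)
    (by rintro (_ | _) <;> assumption)
  simpa [Bool.forall_bool, and_comm] using this

theorem exists_family {ι : Type} [Finite ι]
    {P : ∀ V : Type u, SimpleGraph V → (α ⊕ ι → V) → Prop} (hP : ExPred P) :
    ExPred (fun V G v => ∃ w : ι → V, P V G (Sum.elim v w)) := by
  obtain ⟨γ, hγ, h⟩ := hP
  refine ⟨ι ⊕ γ, inferInstance, ?_⟩
  rintro V G v ⟨w, hw⟩
  obtain ⟨z, hz⟩ := h V G _ hw
  refine ⟨Sum.elim w z, fun W H v' w' hp => ⟨w' ∘ Sum.inl, hz W H _ (w' ∘ Sum.inr) ?_⟩⟩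
  convert hp.comp (Equiv.sumAssoc α ι γ) using 1 <;>
  · ext ((i | i) | i) <;> rfl

theorem map_embedding {P : ∀ V : Type u, SimpleGraph V → (α → V) → Prop} (hP : ExPred P)
    {V W : Type u} {G : SimpleGraph V} {H : SimpleGraph W} (f : G ↪g H) {v : α → V}
    (hv : P V G v) : P W H (f ∘ v) := by
  obtain ⟨γ, -, h⟩ := hP
  obtain ⟨w, hw⟩ := h V G v hv
  refine hw W H _ (f ∘ w) ?_
  rw [← Sum.comp_elim]
  exact .of_embedding f _

end ExPred

/-! ### Existential predicates and existential formulas -/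

section Formula

open FirstOrder.Language BoundedFormula

theorem isQF_iInf {L : Language} {α : Type*} {n : ℕ} {β : Type*} [Finite β]
    {f : β → L.BoundedFormula α n} (h : ∀ b, (f b).IsQF) : (iInf f).IsQF := by
  let := Fintype.ofFinite β
  change IsQF (List.foldr _ _ (List.map f (Finset.univ : Finset β).toList))
  generalize (Finset.univ : Finset β).toList = l
  induction l with
  | nil => exact IsQF.top
  | cons b l ih => exact (h b).inf ih

theorem isQF_iSup {L : Language} {α : Type*} {n : ℕ} {β : Type*} [Finite β]
    {f : β → L.BoundedFormula α n} (h : ∀ b, (f b).IsQF) : (iSup f).IsQF := by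
  let := Fintype.ofFinite β
  change IsQF (List.foldr _ _ (List.map f (Finset.univ : Finset β).toList))
  generalize (Finset.univ : Finset β).toList = l
  induction l with
  | nil => exact isQF_bot
  | cons b l ih => exact (h b).sup ih

theorem isExistential_exs {L : Language} {α : Type*} {n : ℕ} {φ : L.BoundedFormula α n}
    (h : φ.IsExistential) : φ.exs.IsExistential := by
  induction n with
  | zero => exact h
  | succ n ih => exact ih h.ex

/-- The outer `exs` makes the induction uniform in the number of bound variables: a quantifier of
`φ` is absorbed into the block. -/
theorem exists_isQF_exs_eq {L : Language} {α : Type*} {n : ℕ} {φ : L.BoundedFormula α n}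
    (h : φ.IsExistential) : ∃ (k : ℕ) (ψ : L.BoundedFormula α k), ψ.IsQF ∧ φ.exs = ψ.exs := by
  induction h with
  | of_isQF h => exact ⟨_, _, h, rfl⟩
  | ex _ ih => exact ih

theorem term_eq_var {α : Type*} (t : Language.graph.Term α) : ∃ i, t = Term.var i := by
  cases t with
  | var i => exact ⟨i, rfl⟩
  | func f _ => exact f.elim

theorem SamePattern.realize_iff {V W : Type u} {G : SimpleGraph V} {H : SimpleGraph W} {α : Type}
    {n : ℕ} {φ : Language.graph.BoundedFormula α n} (hφ : φ.IsQF) {v : α → V} {x : Fin n → V}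
    {w : α → W} {y : Fin n → W} (h : SamePattern G (Sum.elim v x) H (Sum.elim w y)) :
    (letI := G.structure; φ.Realize v x) ↔ (letI := H.structure; φ.Realize w y) := by
  induction hφ with
  | falsum => exact Iff.rfl
  | imp _ _ h₁ h₂ => exact imp_congr h₁ h₂
  | of_isAtomic hA =>
    cases hA with
    | equal t₁ t₂ =>
      obtain ⟨i, rfl⟩ := term_eq_var t₁
      obtain ⟨j, rfl⟩ := term_eq_var t₂
      exact h.eq_iff i j
    | rel R ts =>
      choose i hi using fun a => term_eq_var (ts a)
      obtain rfl : ts = fun a => Term.var (i a) := funext hi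
      cases R
      exact h.adj_iff (i 0) (i 1)

theorem exPred_of_isExistential {n : ℕ} {φ : Language.graph.Formula (Fin n)}
    (hφ : φ.IsExistential) : ExPred (fun (V : Type u) G (v : Fin n → V) => Sat G φ v) := by
  obtain ⟨k, ψ, hψ, h⟩ := exists_isQF_exs_eq hφ
  -- A formula has no bound variables left to quantify, so `φ.exs` is `φ` by definition.
  obtain rfl : φ = ψ.exs := h
  refine ⟨Fin k, inferInstance, fun V G v hv => ?_⟩
  let := G.structure
  obtain ⟨w, hw⟩ := BoundedFormula.realize_exs.1 hv
  refine ⟨w, fun W H v' w' hp => ?_⟩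
  let := H.structure
  exact BoundedFormula.realize_exs.2 ⟨w', (hp.realize_iff hψ).1 hw⟩

open Classical in
/-- The quantifier-free formula that describes the equality and adjacency pattern `p`. -/
noncomputable def diagram {n k : ℕ} (p : (Fin n ⊕ Fin k) × (Fin n ⊕ Fin k) → Prop × Prop) :
    Language.graph.BoundedFormula (Fin n) k :=
  iInf fun x : (Fin n ⊕ Fin k) × (Fin n ⊕ Fin k) =>
    (if (p x).1 then (Term.var x.1).bdEqual (Term.var x.2)
      else ((Term.var x.1).bdEqual (Term.var x.2)).not) ⊓
    (if (p x).2 then adj.boundedFormula₂ (Term.var x.1) (Term.var x.2)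
      else (adj.boundedFormula₂ (Term.var x.1) (Term.var x.2)).not)

theorem isQF_diagram {n k : ℕ} (p : (Fin n ⊕ Fin k) × (Fin n ⊕ Fin k) → Prop × Prop) :
    (diagram p).IsQF := by
  refine isQF_iInf fun x => IsQF.inf ?_ ?_
  · split_ifs
    · exact (IsAtomic.equal _ _).isQF
    · exact (IsAtomic.equal _ _).isQF.not
  · split_ifs
    · exact (IsAtomic.rel _ _).isQF
    · exact (IsAtomic.rel _ _).isQF.not

theorem realize_diagram {n k : ℕ} (p : (Fin n ⊕ Fin k) × (Fin n ⊕ Fin k) → Prop × Prop)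
    {V : Type u} (G : SimpleGraph V) (v : Fin n → V) (w : Fin k → V) :
    (letI := G.structure; (diagram p).Realize v w) ↔
      (fun x : (Fin n ⊕ Fin k) × (Fin n ⊕ Fin k) =>
        (Sum.elim v w x.1 = Sum.elim v w x.2, G.Adj (Sum.elim v w x.1) (Sum.elim v w x.2))) = p := by
  let := G.structure
  have hadj : ∀ a b : V, Structure.RelMap adj ![a, b] ↔ G.Adj a b := fun a b => Iff.rfl
  rw [diagram, BoundedFormula.realize_iInf, funext_iff]
  refine forall_congr' fun x => ?_
  rw [Prod.ext_iff, BoundedFormula.realize_inf]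
  refine and_congr ?_ ?_
  · split_ifs with h <;> simp [h]
  · split_ifs with h <;> simp [h, hadj]

/-- Only finitely many patterns exist on `n + k` vertices. The formula is the disjunction,
existentially quantified, of the diagrams of those patterns that force `P` in every graph. -/
theorem ExPred.exists_formula {n : ℕ} {P : ∀ V : Type u, SimpleGraph V → (Fin n → V) → Prop}
    (hP : ExPred P) : ∃ φ : Language.graph.Formula (Fin n), φ.IsExistential ∧
      ∀ V (G : SimpleGraph V) v, Sat G φ v ↔ P V G v := by
  obtain ⟨β, hβ, h⟩ := hP
  obtain ⟨k, ⟨e⟩⟩ := Finite.exists_equiv_fin β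
  let good := {p : (Fin n ⊕ Fin k) × (Fin n ⊕ Fin k) → Prop × Prop //
    ∀ W (H : SimpleGraph W) v w, (letI := H.structure; (diagram p).Realize v w) → P W H v}
  refine ⟨(iSup fun p : good => diagram p.1).exs,
    isExistential_exs (isQF_iSup fun p => isQF_diagram _).isExistential, fun V G v => ?_⟩
  let := G.structure
  refine BoundedFormula.realize_exs.trans ?_
  simp only [BoundedFormula.realize_iSup]
  constructor
  · rintro ⟨w, p, hw⟩
    exact p.2 V G v w hw
  · intro hv
    obtain ⟨w, hw⟩ := h V G v hv
    refine ⟨w ∘ e.symm, ⟨_, fun W H v' w' hp => ?_⟩, (realize_diagram _ G v _).2 rfl⟩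
    rw [realize_diagram, funext_iff] at hp
    refine hw W H v' (w' ∘ e) ?_
    have hp' : SamePattern G (Sum.elim v (w ∘ e.symm)) H (Sum.elim v' w') :=
      ⟨fun i j => ((Prod.ext_iff.1 (hp (i, j))).1).symm.to_iff,
        fun i j => ((Prod.ext_iff.1 (hp (i, j))).2).symm.to_iff⟩
    convert hp'.comp (Sum.map id e) using 1 <;>
    · ext (i | i) <;> simp

end Formula

/-! ### Existentially complete graphs and algebraic closure -/

theorem MemE.reflect {𝒞 : Set FinGraph} {V W : Type u} {G : SimpleGraph V} (hG : MemE 𝒞 G)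
    {H : SimpleGraph W} (hH : MemG 𝒞 H) (f : G ↪g H) {α : Type*} [Finite α]
    {P : ∀ V : Type u, SimpleGraph V → (α → V) → Prop} (hP : ExPred P) {v : α → V}
    (hv : P W H (f ∘ v)) : P V G v := by
  obtain ⟨n, ⟨e⟩⟩ := Finite.exists_equiv_fin α
  obtain ⟨φ, hφ, h⟩ := (hP.comp e).exists_formula
  have := hG.2 W H hH f n φ (v ∘ e.symm) hφ ((h W H _).2 (by simpa [Function.comp_def] using hv))
  simpa [Function.comp_def] using (h V G _).1 this

/-- The index `none` stands for the algebraic element, `some i` for the parameters. -/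
theorem mem_acl_of_exPred {V : Type u} {G : SimpleGraph V} {X : Set V} {α : Type*} [Finite α]
    {P : ∀ V : Type u, SimpleGraph V → (Option α → V) → Prop} (hP : ExPred P) {a : α → V}
    (ha : ∀ i, a i ∈ X) (hfin : {y | P V G (fun o => o.elim y a)}.Finite) {x : V}
    (hx : P V G (fun o => o.elim x a)) : x ∈ acl G X := by
  obtain ⟨n, ⟨e⟩⟩ := Finite.exists_equiv_fin α
  obtain ⟨φ, hφ, h⟩ := (hP.comp (fun o : Option α => o.elim (Fin.last n)
    (fun i => Fin.castSucc (e i)))).exists_formula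
  have key : ∀ y : V, Sat G φ (Fin.snoc (a ∘ e.symm) y : Fin (n + 1) → V) ↔
      P V G (fun o => o.elim y a) := fun y => by
    rw [h]
    refine iff_of_eq (congrArg _ (funext fun o => ?_))
    cases o <;> simp
  exact ⟨n, φ, a ∘ e.symm, hφ, fun i => ha _, by simpa only [key] using hfin, (key x).2 hx⟩

theorem exists_exPred_of_mem_acl {V : Type u} {G : SimpleGraph V} {X : Set V} {x : V}
    (hx : x ∈ acl G X) : ∃ (n : ℕ) (a : Fin n → V)
      (P : ∀ V : Type u, SimpleGraph V → (Option (Fin n) → V) → Prop), ExPred P ∧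
      (∀ i, a i ∈ X) ∧ {y | P V G (fun o => o.elim y a)}.Finite ∧
      P V G (fun o => o.elim x a) := by
  obtain ⟨n, φ, a, hφ, ha, hfin, hx⟩ := hx
  have key : ∀ y : V, ((fun o : Option (Fin n) => o.elim y a) ∘ finSuccEquivLast) =
      (Fin.snoc a y : Fin (n + 1) → V) := fun y => by
    ext i
    refine Fin.lastCases ?_ (fun i => ?_) i <;> simp
  refine ⟨n, a, _, (exPred_of_isExistential hφ).comp finSuccEquivLast, ha, ?_, ?_⟩
  · simpa only [key] using hfin
  · simpa only [key] using hx

theorem acl_mono {V : Type u} (G : SimpleGraph V) {X Y : Set V} (h : X ⊆ Y) :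
    acl G X ⊆ acl G Y := by
  rintro x ⟨n, φ, a, hφ, ha, hfin, hx⟩
  exact ⟨n, φ, a, hφ, fun i => h (ha i), hfin, hx⟩

theorem subset_acl {V : Type u} (G : SimpleGraph V) (X : Set V) : X ⊆ acl G X := by
  intro x hx
  refine mem_acl_of_exPred (α := Unit) (P := fun V _ v => v none = v (some ()))
    (.of_pattern fun V G v W H w h hv => (h.eq_iff _ _).1 hv) (a := fun _ => x)
    (fun _ => hx) ?_ rfl
  simp

/-! ### Neumann's lemma for existentially definable sets of tuples -/

/-- The finite set `T` meets the range of every member of `D`. -/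
def Hits {ι V : Type*} (D : Set (ι → V)) (T : Finset V) : Prop :=
  ∀ d ∈ D, ∃ i, d i ∈ T

/-- A finite part of `D` has the same small hitting sets as `D`. -/
theorem exists_finite_forall_hits {ι V : Type*} [Finite ι] [DecidableEq V] (D : Set (ι → V))
    (k : ℕ) : ∀ T : Finset V, ∃ F ⊆ D, F.Finite ∧
      ∀ T' : Finset V, T ⊆ T' → T'.card ≤ T.card + k → Hits F T' → Hits D T' := by
  induction k with
  | zero =>
    intro T
    by_cases hT : Hits D T
    · refine ⟨∅, Set.empty_subset _, Set.finite_empty, fun T' h₁ h₂ _ => ?_⟩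
      rwa [← Finset.eq_of_subset_of_card_le h₁ h₂]
    · obtain ⟨d, hd, h⟩ : ∃ d ∈ D, ∀ i, d i ∉ T := by simpa [Hits] using hT
      refine ⟨{d}, by simpa, Set.finite_singleton d, fun T' h₁ h₂ h₃ => ?_⟩
      rw [← Finset.eq_of_subset_of_card_le h₁ h₂] at h₃
      obtain ⟨i, hi⟩ := h₃ d rfl
      exact absurd hi (h i)
  | succ k ih =>
    intro T
    by_cases hT : Hits D T
    · refine ⟨∅, Set.empty_subset _, Set.finite_empty, fun T' h₁ _ _ d hd => ?_⟩
      obtain ⟨i, hi⟩ := hT d hd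
      exact ⟨i, h₁ hi⟩
    · obtain ⟨d, hd, h⟩ : ∃ d ∈ D, ∀ i, d i ∉ T := by simpa [Hits] using hT
      -- A hitting set that extends `T` must contain some `d i`, so the search branches over the
      -- finite type `ι`, and each branch uses up one of the `k` additional elements.
      choose F hFD hF hFT using fun i => ih (insert (d i) T)
      refine ⟨insert d (⋃ i, F i), Set.insert_subset hd (Set.iUnion_subset hFD),
        (Set.finite_iUnion hF).insert d, fun T' h₁ h₂ h₃ => ?_⟩
      obtain ⟨i, hi⟩ := h₃ d (Set.mem_insert _ _)
      refine hFT i T' (Finset.insert_subset hi h₁) ?_ fun e he =>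
        h₃ e (Set.mem_insert_of_mem _ (Set.mem_iUnion_of_mem i he))
      rw [Finset.card_insert_of_notMem (h i)]
      omega

/-- An existentially definable set of tuples over an algebraically closed set `X` that contains a
tuple outside `X` contains tuples avoiding any given finite set. -/
theorem exists_mem_avoiding {V : Type u} {G : SimpleGraph V} {X : Set V} (hX : acl G X ⊆ X)
    {ι α : Type} [Finite ι] [Finite α]
    {P : ∀ V : Type u, SimpleGraph V → (α ⊕ ι → V) → Prop} (hP : ExPred P) {a : α → V}
    (ha : ∀ i, a i ∈ X) {b : ι → V} (hb : ∀ i, b i ∉ X) (hab : P V G (Sum.elim a b))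
    (S : Finset V) : ∃ d : ι → V, P V G (Sum.elim a d) ∧ ∀ i, d i ∉ S := by
  classical
  set D : Set (ι → V) := {d | P V G (Sum.elim a d)} with hD
  by_contra hcon
  have hS : Hits D S := by
    intro d hd
    by_contra h
    exact hcon ⟨d, hd, by simpa using h⟩
  have hex : ∃ n, ∃ T : Finset V, T.card = n ∧ Hits D T := ⟨_, S, rfl, hS⟩
  set n := Nat.find hex
  obtain ⟨T₀, hT₀n, hT₀⟩ := Nat.find_spec hex
  have hmin : ∀ T : Finset V, Hits D T → n ≤ T.card := fun T hT => Nat.find_min' hex ⟨T, rfl, hT⟩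
  -- Up to the minimal size `n`, hitting the finite part `F` is the same as hitting `D`.
  obtain ⟨F, hFD, hFfin, hF⟩ := exists_finite_forall_hits D n ∅
  have hF' : ∀ T : Finset V, T.card ≤ n → Hits F T → Hits D T := fun T h =>
    hF T (Finset.empty_subset T) (by simpa using h)
  -- members of a hitting set of minimal size lie in the range of a member of `F`
  have hmem : ∀ T : Finset V, T.card = n → Hits D T → ∀ s ∈ T, ∃ f ∈ F, ∃ i, f i = s := by
    intro T hTn hT s hs
    by_contra! h
    have h₁ : Hits D (T.erase s) := by
      refine hF' _ ((Finset.card_erase_le).trans hTn.le) fun f hf => ?_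
      obtain ⟨i, hi⟩ := hT f (hFD hf)
      exact ⟨i, Finset.mem_erase.2 ⟨h f hf i, hi⟩⟩
    have h₂ := hmin _ h₁
    have := Finset.card_erase_lt_of_mem hs
    omega
  have hfinite : {T : Finset V | T.card = n ∧ Hits D T}.Finite := by
    have hΩ : (⋃ f ∈ F, Set.range f).Finite := hFfin.biUnion fun f _ => Set.finite_range f
    refine (hΩ.toFinset.powerset.finite_toSet).subset fun T hT => ?_
    rw [Finset.mem_coe, Finset.mem_powerset]
    intro s hs
    obtain ⟨f, hf, i, rfl⟩ := hmem T hT.1 hT.2 s hs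
    simp only [Set.Finite.mem_toFinset, Set.mem_iUnion]
    exact ⟨f, hf, i, rfl⟩
  -- any hitting set of minimal size is contained in `X`
  have hsub : ∀ s ∈ T₀, s ∈ X := by
    intro s hs
    obtain ⟨f₀, hf₀, i₀, rfl⟩ := hmem T₀ hT₀n hT₀ s hs
    obtain ⟨m, ⟨e⟩⟩ := @Finite.exists_equiv_fin F hFfin.to_subtype
    let f : Fin m → ι → V := fun j => (e.symm j : ι → V)
    have hfF : ∀ j, f j ∈ F := fun j => (e.symm j).2
    have hfs : ∀ g ∈ F, ∃ j, f j = g := fun g hg => ⟨e ⟨g, hg⟩, by simp [f]⟩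
    obtain ⟨j₀, rfl⟩ := hfs f₀ hf₀
    -- The existential formula says of `x` that it occupies the place `(j₀, i₀)` in some family `w`
    -- of members of `D` with the same equalities as the enumerated family `f` of `F`. Its solutions
    -- will be shown to lie in the finitely many hitting sets of minimal size.
    refine hX (mem_acl_of_exPred (α := α) (a := a)
      (P := fun W H v => ∃ w : Fin m × ι → W,
        (∀ j, P W H (Sum.elim (v ∘ some) (fun i => w (j, i)))) ∧
        (∀ x : (Fin m × ι) × (Fin m × ι), w x.1 = w x.2 ↔ f x.1.1 x.1.2 = f x.2.1 x.2.2) ∧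
        v none = w (j₀, i₀)) ?_ ha ?_ ?_)
    · refine ExPred.exists_family (ι := Fin m × ι) (P := fun W H v =>
        (∀ j, P W H (Sum.elim ((v ∘ Sum.inl) ∘ some) (fun i => v (Sum.inr (j, i))))) ∧
        (∀ x : (Fin m × ι) × (Fin m × ι),
          v (Sum.inr x.1) = v (Sum.inr x.2) ↔ f x.1.1 x.1.2 = f x.2.1 x.2.2) ∧
        v (Sum.inl none) = v (Sum.inr (j₀, i₀))) (.and (.forall_finite fun j => ?_) ?_)
      · have := hP.comp (Sum.elim (fun x => Sum.inl (some x)) (fun i => Sum.inr (j, i)) :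
          α ⊕ ι → Option α ⊕ (Fin m × ι))
        convert this using 5
        ext (x | x) <;> rfl
      · refine .of_pattern fun W H v W' H' v' h hv => ⟨fun x => ?_, ?_⟩
        · rw [← h.eq_iff]
          exact hv.1 x
        · rw [← h.eq_iff]
          exact hv.2
    · refine (hfinite.biUnion fun T _ => T.finite_toSet).subset ?_
      rintro x ⟨w, hwD, hwf, hx⟩
      replace hx : x = w (j₀, i₀) := hx
      have hwf' : ∀ j i j' i', w (j, i) = w (j', i') ↔ f j i = f j' i' := fun j i j' i' =>
        hwf ((j, i), (j', i'))
      -- `τ` translates the elements of `T` that occur in `w` into the corresponding elements of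
      -- `f`. Since the rows of `w` belong to `D`, a set `T` that hits `D` yields a set `τ T` that
      -- hits `F`.
      let τ : Finset V → Finset V := fun T =>
        ((Set.toFinite {x : Fin m × ι | w x ∈ T}).image (fun x => f x.1 x.2)).toFinset
      have hτmem : ∀ T j i, f j i ∈ τ T ↔ w (j, i) ∈ T := by
        intro T j i
        simp only [τ, Set.Finite.mem_toFinset, Set.mem_image, Set.mem_ofPred_eq, Prod.exists]
        constructor
        · rintro ⟨j', i', h, h'⟩
          rwa [← (hwf' j' i' j i).2 h']
        · exact fun h => ⟨j, i, h, rfl⟩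
      have hτmem' : ∀ T, ∀ v ∈ τ T, ∃ j i, f j i = v ∧ w (j, i) ∈ T := by
        intro T v hv
        simp only [τ, Set.Finite.mem_toFinset, Set.mem_image, Set.mem_ofPred_eq, Prod.exists] at hv
        obtain ⟨j, i, h, rfl⟩ := hv
        exact ⟨j, i, rfl, h⟩
      -- transport back from `w` to `f`
      have hback : ∀ T, ∃ σ : V → V, (∀ v ∈ τ T, σ v ∈ T) ∧ Set.InjOn σ (τ T : Set V) ∧
          ∀ v ∈ τ T, ∀ j i, f j i = v → σ v = w (j, i) := by
        intro T
        have : Nonempty (Fin m) := ⟨j₀⟩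
        have : Nonempty ι := ⟨i₀⟩
        choose! J I hJI using hτmem' T
        refine ⟨fun v => w (J v, I v), fun v hv => (hJI v hv).2, fun v hv v' hv' h => ?_,
          fun v hv j i h => ?_⟩
        · rw [← (hJI v hv).1, ← (hJI v' hv').1]
          exact (hwf' _ _ _ _).1 h
        · exact (hwf' _ _ _ _).2 ((hJI v hv).1.trans h.symm)
      have hτhits : ∀ T, T.card = n → Hits D T → (τ T).card = n ∧ Hits D (τ T) := by
        intro T hTn hT
        obtain ⟨σ, hσ, hinj, -⟩ := hback T
        have hle : (τ T).card ≤ n := hTn ▸ Finset.card_le_card_of_injOn σ hσ hinj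
        have hh : Hits D (τ T) := by
          refine hF' _ hle fun g hg => ?_
          obtain ⟨j, rfl⟩ := hfs g hg
          obtain ⟨i, hi⟩ := hT (fun i => w (j, i)) (hwD j)
          exact ⟨i, (hτmem T j i).2 hi⟩
        exact ⟨le_antisymm hle (hmin _ hh), hh⟩
      have hτinj : Set.InjOn τ {T : Finset V | T.card = n ∧ Hits D T} := by
        have himg : ∀ T, T.card = n → Hits D T →
            ∀ t, t ∈ T ↔ ∃ j i, f j i ∈ τ T ∧ w (j, i) = t := by
          intro T hTn hT t
          obtain ⟨σ, hσ, hinj, hσf⟩ := hback T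
          constructor
          · intro ht
            have : Finset.image σ (τ T) = T := by
              refine Finset.eq_of_subset_of_card_le (Finset.image_subset_iff.2 hσ) ?_
              rw [Finset.card_image_of_injOn hinj, (hτhits T hTn hT).1, hTn]
            rw [← this, Finset.mem_image] at ht
            obtain ⟨v, hv, rfl⟩ := ht
            obtain ⟨j, i, rfl, -⟩ := hτmem' T v hv
            exact ⟨j, i, hv, (hσf _ hv j i rfl).symm⟩
          · rintro ⟨j, i, h, rfl⟩
            exact (hτmem T j i).1 h
        intro T hT T' hT' h
        ext t
        rw [himg T hT.1 hT.2, himg T' hT'.1 hT'.2, h]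
      have hmaps : τ '' {T : Finset V | T.card = n ∧ Hits D T} ⊆ {T | T.card = n ∧ Hits D T} := by
        rintro _ ⟨T, hT, rfl⟩
        exact hτhits T hT.1 hT.2
      -- An injective self-map of a finite set is onto, so `T₀` is some `τ T`; as `f j₀ i₀ ∈ T₀`,
      -- the solution `w (j₀, i₀)` lies in that `T`.
      have hsurj := Set.eq_of_subset_of_ncard_le hmaps hτinj.ncard_image.ge hfinite
      obtain ⟨T, hT, hTT₀⟩ := hsurj.ge (show T₀ ∈ _ from ⟨hT₀n, hT₀⟩)
      simp only [Set.mem_iUnion]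
      exact ⟨T, hT, hx ▸ (hτmem T j₀ i₀).1 (hTT₀ ▸ hs)⟩
    · exact ⟨fun x => f x.1 x.2, fun j => hFD (hfF j), fun x => Iff.rfl, rfl⟩
  obtain ⟨i, hi⟩ := hT₀ b hab
  exact hb i (hsub _ hi)

/-! ### The free amalgam of two copies of a graph over a set of vertices -/

section Double

variable {V : Type u} (G : SimpleGraph V) (X : Set V)

/-- The vertices of two copies of a graph that share the vertices in `X`. -/
abbrev DoubleVert (X : Set V) : Type u := {p : V × Bool // p.1 ∈ X → p.2 = false}

/-- The free amalgam of two copies of `G` over `X`. -/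
def double : SimpleGraph (DoubleVert X) where
  Adj p q := G.Adj p.1.1 q.1.1 ∧ (p.1.1 ∈ X ∨ q.1.1 ∈ X ∨ p.1.2 = q.1.2)
  symm := ⟨fun _ _ h => ⟨h.1.symm, by tauto⟩⟩
  loopless := ⟨fun _ h => G.loopless.irrefl _ h.1⟩

/-- The vertices of the copy number `i`. -/
def side (i : Bool) : Set (DoubleVert X) := {p | p.1.1 ∈ X ∨ p.1.2 = i}

open Classical in
/-- The inclusion of the copy number `i`. -/
noncomputable def inclusion (i : Bool) : G ↪g double G X where
  toFun v := ⟨(v, if v ∈ X then false else i), fun h => if_pos h⟩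
  inj' v w h := congrArg (fun p : DoubleVert X => p.1.1) h
  map_rel_iff' {v w} := by
    change (G.Adj v w ∧ (v ∈ X ∨ w ∈ X ∨ (if v ∈ X then false else i) = if w ∈ X then false else i))
      ↔ G.Adj v w
    by_cases hv : v ∈ X <;> by_cases hw : w ∈ X <;> simp [hv, hw]

variable {G X}

@[simp] theorem inclusion_fst (i : Bool) (v : V) : (inclusion G X i v).1.1 = v := rfl

theorem inclusion_mem_side (i : Bool) (v : V) : inclusion G X i v ∈ side X i := by
  by_cases h : v ∈ X
  · exact Or.inl h
  · exact Or.inr (if_neg h)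

theorem inclusion_of_mem_side {i : Bool} {p : DoubleVert X} (hp : p ∈ side X i) :
    inclusion G X i p.1.1 = p := by
  classical
  refine Subtype.ext (Prod.ext rfl ?_)
  change (if p.1.1 ∈ X then false else i) = p.1.2
  split_ifs with h
  · exact (p.2 h).symm
  · exact (hp.resolve_left h).symm

theorem mem_side_iff_of_fst_notMem {p : DoubleVert X} (hp : p.1.1 ∉ X) (i : Bool) :
    p ∈ side X i ↔ p.1.2 = i :=
  ⟨fun h => h.resolve_left hp, Or.inr⟩

theorem double_ext {p q : DoubleVert X} (h : p.1.1 = q.1.1) (hp : p.1.1 ∈ X) : p = q :=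
  Subtype.ext (Prod.ext h ((p.2 hp).trans (q.2 (h ▸ hp)).symm))

theorem double_adj_mem_side {p q : DoubleVert X} (h : (double G X).Adj p q) {i : Bool}
    (hp : p ∈ side X i) (hpX : p.1.1 ∉ X) : q ∈ side X i := by
  rw [mem_side_iff_of_fst_notMem hpX] at hp
  rcases h.2 with h | h | h
  · exact absurd h hpX
  · exact Or.inl h
  · exact Or.inr (h.symm.trans hp)

/-- An injective homomorphism into one of the copies gives a copy in `G`. -/
theorem isContained_of_forall_mem_side {N : Type*} {C : SimpleGraph N} {g : N → DoubleVert X}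
    (hinj : Function.Injective g) (hadj : ∀ u v, C.Adj u v → (double G X).Adj (g u) (g v))
    {i : Bool} (hi : ∀ v, g v ∈ side X i) : C.IsContained G := by
  refine ⟨⟨⟨fun v => (g v).1.1, fun {u v} h => (hadj u v h).1⟩, fun u v h => hinj ?_⟩⟩
  rw [← inclusion_of_mem_side (G := G) (hi u), ← inclusion_of_mem_side (G := G) (hi v)]
  exact congrArg (inclusion G X i) h

theorem memG_double {𝒞 : Set FinGraph} (hG : MemG 𝒞 G) (h : Omits 𝒞 (double G X)) :
    MemG 𝒞 (double G X) := by
  have := hG.1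
  exact ⟨inferInstance, h⟩

/-- If the amalgam over `X` omits the forbidden subgraphs then `X` is algebraically closed. -/
theorem acl_subset_of_omits_double {𝒞 : Set FinGraph} (hG : MemE 𝒞 G)
    (h : Omits 𝒞 (double G X)) : acl G X ⊆ X := by
  intro x hx
  by_contra hxX
  obtain ⟨n, a, P, hP, ha, hfin, hx⟩ := exists_exPred_of_mem_acl hx
  obtain ⟨m, ⟨e⟩⟩ := @Finite.exists_equiv_fin _ hfin.to_subtype
  let s : Fin m → V := fun j => e.symm j
  have hs : ∀ y, P V G (fun o => o.elim y a) → ∃ j, s j = y := fun y hy =>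
    ⟨e ⟨y, hy⟩, by simp [s]⟩
  -- The list `s` exhausts the solutions in `G`. In the amalgam, `x` in copy `true` is a further
  -- solution, because the parameters lie in the shared part `X`. Reflecting this contradicts the
  -- choice of `s`.
  have key := hG.reflect (memG_double hG.1 h) (inclusion G X false) (α := Fin n ⊕ Fin m)
    (v := Sum.elim a s) (P := fun W H v => ∃ w : Unit → W,
      P W H (fun o => o.elim (w ()) (v ∘ Sum.inl)) ∧ ∀ j, v (Sum.inr j) ≠ w ()) ?_ ?_
  · obtain ⟨w, hw, hne⟩ := key
    obtain ⟨j, hj⟩ := hs _ hw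
    exact hne j hj
  · refine ExPred.exists_family (P := fun W H (v : (Fin n ⊕ Fin m) ⊕ Unit → W) =>
      P W H (fun o => o.elim (v (Sum.inr ())) ((v ∘ Sum.inl) ∘ Sum.inl)) ∧
        ∀ j, v (Sum.inl (Sum.inr j)) ≠ v (Sum.inr ())) (.and ?_ ?_)
    · have := hP.comp (fun o => o.elim (Sum.inr ()) (Sum.inl ∘ Sum.inl) :
        Option (Fin n) → (Fin n ⊕ Fin m) ⊕ Unit)
      convert this using 5
      funext o
      cases o <;> rfl
    · exact .of_pattern fun W H v W' H' v' h hv j => by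
        rw [Ne, ← h.eq_iff]
        exact hv j
  · refine ⟨fun _ => inclusion G X true x, ?_, fun j hj => ?_⟩
    · convert hP.map_embedding (inclusion G X true) hx using 1
      ext o : 1
      cases o with
      | none => rfl
      | some i => exact double_ext rfl (ha i)
    · have h₁ : inclusion G X true x ∈ side X false :=
        (show inclusion G X false (s j) = inclusion G X true x from hj) ▸ inclusion_mem_side _ _
      have h₂ : inclusion G X true x ∈ side X true := inclusion_mem_side _ _
      rw [mem_side_iff_of_fst_notMem hxX] at h₁ h₂
      rw [h₁] at h₂
      exact absurd h₂ (by simp)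

/-- The amalgam over an algebraically closed set omits the forbidden subgraphs. -/
theorem omits_double_of_acl_subset {𝒞 : Set FinGraph} (hG : Omits 𝒞 G) (hX : acl G X ⊆ X) :
    Omits 𝒞 (double G X) := by
  classical
  rintro C hC ⟨g⟩
  refine hG C hC ?_
  -- `I` is the part of `C` strictly inside the second copy, and `J` is the part in `X`. Every edge
  -- leaving `I` ends in `J`.
  let I := {c // g c ∉ side X false}
  let J := {c // (g c).1.1 ∈ X}
  have hab : Function.Injective (Sum.elim (fun j : J => (g j.1).1.1) (fun i : I => (g i.1).1.1)) ∧
      ∀ x y : J ⊕ I,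
        C.graph.Adj (Sum.elim Subtype.val Subtype.val x) (Sum.elim Subtype.val Subtype.val y) →
          G.Adj (Sum.elim (fun j : J => (g j.1).1.1) (fun i : I => (g i.1).1.1) x)
            (Sum.elim (fun j : J => (g j.1).1.1) (fun i : I => (g i.1).1.1) y) := by
    have hside : ∀ x : J ⊕ I, g (Sum.elim Subtype.val Subtype.val x) ∈ side X true := by
      rintro (⟨c, hc⟩ | ⟨c, hc⟩)
      · exact Or.inl hc
      · refine Or.inr ?_
        have h₁ : (g c).1.1 ∉ X := fun h => hc (Or.inl h)
        rw [mem_side_iff_of_fst_notMem h₁] at hc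
        simpa using hc
    have heq : (Sum.elim (fun j : J => (g j.1).1.1) (fun i : I => (g i.1).1.1)) =
        fun x : J ⊕ I => (g (Sum.elim Subtype.val Subtype.val x)).1.1 := by
      ext (x | x) <;> rfl
    rw [heq]
    refine ⟨fun x y hxy => ?_, fun x y hxy => (g.toHom.map_adj hxy).1⟩
    have h₁ := g.injective (show g (Sum.elim Subtype.val Subtype.val x) =
        g (Sum.elim Subtype.val Subtype.val y) by
      rw [← inclusion_of_mem_side (G := G) (hside x), ← inclusion_of_mem_side (G := G) (hside y)]
      exact congrArg _ hxy)
    rcases x with ⟨x, hx⟩ | ⟨x, hx⟩ <;> rcases y with ⟨y, hy⟩ | ⟨y, hy⟩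
    · exact congrArg Sum.inl (Subtype.ext h₁)
    · obtain rfl : x = y := h₁
      exact absurd (Or.inl hx) hy
    · obtain rfl : x = y := h₁
      exact absurd (Or.inl hy) hx
    · exact congrArg Sum.inr (Subtype.ext h₁)
  obtain ⟨d, hd, hdS⟩ := exists_mem_avoiding hX (ι := I) (α := J)
    (P := fun W H v => Function.Injective v ∧ ∀ x y : J ⊕ I,
      C.graph.Adj (Sum.elim Subtype.val Subtype.val x) (Sum.elim Subtype.val Subtype.val y) →
        H.Adj (v x) (v y))
    (.of_pattern fun W H v W' H' v' h hv => ⟨fun x y hxy => hv.1 ((h.eq_iff _ _).2 hxy),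
      fun x y hxy => (h.adj_iff _ _).1 (hv.2 x y hxy)⟩)
    (a := fun j => (g j.1).1.1) (b := fun i => (g i.1).1.1) (fun j => j.2)
    (fun i hi => i.2 (Or.inl hi)) hab (Finset.univ.image fun c => (g c).1.1)
  have hIX : ∀ c (hc : g c ∉ side X false) c', (g c').1.1 ∈ X → d ⟨c, hc⟩ ≠ (g c').1.1 :=
    fun c hc c' hc' h => Sum.inr_ne_inl (hd.1 (show Sum.elim _ _ (Sum.inr ⟨c, hc⟩) =
      Sum.elim _ _ (Sum.inl ⟨c', hc'⟩) from h))
  have hIS : ∀ c (hc : g c ∉ side X false) c', d ⟨c, hc⟩ ≠ (g c').1.1 := fun c hc c' h =>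
    hdS ⟨c, hc⟩ (by rw [h]; exact Finset.mem_image_of_mem _ (Finset.mem_univ c'))
  -- The part outside `I` stays in the first copy, and `I` is replaced by the tuple `d`, which has
  -- the required edges to `J` and avoids all old vertices.
  let f : Fin C.order → V := fun c => if h : g c ∈ side X false then (g c).1.1 else d ⟨c, h⟩
  have hadj : ∀ u v, C.graph.Adj u v → G.Adj (f u) (f v) := by
    have hmix : ∀ u v, C.graph.Adj u v → g u ∈ side X false → g v ∉ side X false →
        G.Adj (f u) (f v) := by
      intro u v huv hu hv
      have huX : (g u).1.1 ∈ X := by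
        by_contra huX
        exact hv (double_adj_mem_side (g.toHom.map_adj huv) hu huX)
      simp only [f, dif_pos hu, dif_neg hv]
      exact hd.2 (Sum.inl ⟨u, huX⟩) (Sum.inr ⟨v, hv⟩) huv
    intro u v huv
    by_cases hu : g u ∈ side X false <;> by_cases hv : g v ∈ side X false
    · simp only [f, dif_pos hu, dif_pos hv]
      exact (g.toHom.map_adj huv).1
    · exact hmix u v huv hu hv
    · exact (hmix v u huv.symm hv hu).symm
    · simp only [f, dif_neg hu, dif_neg hv]
      exact hd.2 (Sum.inr ⟨u, hu⟩) (Sum.inr ⟨v, hv⟩) huv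
  refine ⟨⟨⟨f, fun {u v} => hadj u v⟩, fun u v huv => ?_⟩⟩
  change f u = f v at huv
  by_cases hu : g u ∈ side X false <;> by_cases hv : g v ∈ side X false
  · simp only [f, dif_pos hu, dif_pos hv] at huv
    apply g.injective
    change g u = g v
    rw [← inclusion_of_mem_side (G := G) hu, ← inclusion_of_mem_side (G := G) hv, huv]
  · simp only [f, dif_pos hu, dif_neg hv] at huv
    exact absurd huv.symm (hIS v hv u)
  · simp only [f, dif_neg hu, dif_pos hv] at huv
    exact absurd huv (hIS u hu v)
  · simp only [f, dif_neg hu, dif_neg hv] at huv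
    exact congrArg Subtype.val (Sum.inr_injective (hd.1
      (show Sum.elim _ _ (Sum.inr ⟨u, hu⟩) = Sum.elim _ _ (Sum.inr ⟨v, hv⟩) from huv)))

end Double

/-! ### Freeness -/

/-- A finite subgraph `H` is free over `Z` if copies of `H` over `Z` can avoid finite sets. -/
theorem freeOver_of_avoiding {V : Type u} {G : SimpleGraph V} {H : G.Subgraph}
    (hH : H.verts.Finite) {Z : Set V} (hZ : Z ⊆ H.verts)
    (h : ∀ S : Set V, S.Finite → Disjoint S Z → ∃ f : H.coe.Copy G,
      (∀ x : H.verts, (x : V) ∈ Z → f x = x) ∧ Disjoint (Set.range f) S) : FreeOver G Z H := by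
  have := hH.to_subtype
  let Ω := {S : Set V // S.Finite ∧ Disjoint S Z}
  choose F hFZ hFS using fun S : Ω => h S.1 S.2.1 S.2.2
  have hZr : ∀ S : Ω, Z ⊆ Set.range (F S) := fun S z hz =>
    ⟨⟨z, hZ hz⟩, hFZ S ⟨z, hZ hz⟩ hz⟩
  -- The forbidden set grows by the new points of each chosen copy, so later copies meet earlier
  -- ones only in `Z`.
  let step : Ω → Ω := fun S => ⟨S.1 ∪ (Set.range (F S) \ Z),
    S.2.1.union ((Set.finite_range _).sdiff), S.2.2.union_left Set.disjoint_sdiff_left⟩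
  let S : ℕ → Ω := fun n => step^[n] (⟨∅, Set.finite_empty, Set.empty_disjoint Z⟩ : Ω)
  have hSs : ∀ n, (S (n + 1)).1 = (S n).1 ∪ (Set.range (F (S n)) \ Z) := fun n => by
    simp only [S, Function.iterate_succ_apply']
    rfl
  have hmono : Monotone fun n => (S n).1 := monotone_nat_of_le_succ fun n => by
    rw [hSs]
    exact Set.subset_union_left
  have hlt : ∀ i j, i < j → Set.range (F (S i)) ∩ Set.range (F (S j)) ⊆ Z := by
    rintro i j hij x ⟨hi, hj⟩
    by_contra hx
    have h₁ : x ∈ (S (i + 1)).1 := by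
      rw [hSs]
      exact Or.inr ⟨hi, hx⟩
    exact Set.disjoint_left.1 (hFS (S j)) hj (hmono hij h₁)
  refine ⟨fun i => F (S i), fun i => hFZ (S i), fun i j hij => ?_⟩
  refine Set.Subset.antisymm ?_ (Set.subset_inter (hZr (S i)) (hZr (S j)))
  rcases lt_or_gt_of_ne hij with hij | hij
  · exact hlt i j hij
  · rw [Set.inter_comm]
    exact hlt j i hij

/-- Copies are disjoint outside `Z`, so each point of `S` outside `Z` spoils at most one of
infinitely many copies. -/
theorem FreeOver.exists_avoiding {V : Type u} {G : SimpleGraph V} {H : G.Subgraph} {Z : Set V}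
    (h : FreeOver G Z H) {S : Set V} (hS : S.Finite) : ∃ f : H.coe.Copy G,
      (∀ x : H.verts, (x : V) ∈ Z → f x = x) ∧ Set.range f ∩ S ⊆ Z := by
  obtain ⟨f, hfZ, hf⟩ := h
  by_contra! hcon
  have hex : ∀ k, ∃ s, s ∈ Set.range (f k) ∧ s ∈ S ∧ s ∉ Z := fun k => by
    obtain ⟨s, hs, hsZ⟩ := Set.not_subset.1 (hcon (f k) (hfZ k))
    exact ⟨s, hs.1, hs.2, hsZ⟩
  choose s hsr hsS hsZ using hex
  have hinj : Function.Injective s := fun i j hij => by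
    by_contra hne
    exact hsZ i ((hf i j hne).subset ⟨hsr i, hij ▸ hsr j⟩)
  exact Set.infinite_of_injective_forall_mem hinj hsS hS

theorem freeOver_verts {V : Type u} {G : SimpleGraph V} (H : G.Subgraph) :
    FreeOver G H.verts H :=
  ⟨fun _ => H.coeCopy, fun _ _ _ => rfl, fun _ _ _ => by
    have : Set.range (H.coeCopy : H.verts → V) = H.verts := Subtype.range_coe
    rw [Set.inter_self]
    exact this⟩

/-- If the closure of a pair is contained in `X` then the pair is free over a part of `X`. -/
theorem exists_freeOver_of_cl_subset {V : Type u} {G : SimpleGraph V} {H : G.Subgraph}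
    (hH : H.verts.Finite) {A X : Set V} (hA : A ⊆ H.verts) (h : cl G A H ⊆ X) :
    ∃ B ⊆ X, B ⊆ H.verts ∧ FreeOver G (A ∪ B) H := by
  have hfin : {B' : Set V | B' ⊆ H.verts ∧ FreeOver G (A ∪ B') H}.Finite :=
    hH.finite_subsets.subset fun B' h => h.1
  obtain ⟨B, hB⟩ := hfin.exists_minimal ⟨H.verts, subset_rfl, by
    rw [Set.union_eq_self_of_subset_left hA]
    exact freeOver_verts H⟩
  exact ⟨B, fun b hb => h (Or.inr ⟨B, hB, hb⟩), hB.prop.1, hB.prop.2⟩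

/-- The closure of a finite pair over a subset of an algebraically closed set stays inside. -/
theorem cl_subset_of_acl_subset {V : Type u} {G : SimpleGraph V} {𝒞 : Set FinGraph}
    (hG : MemE 𝒞 G) {X : Set V} (hX : acl G X ⊆ X) {H : G.Subgraph} (hH : H.verts.Finite)
    {A : Set V} (hA : A ⊆ H.verts) (hAX : A ⊆ X) : cl G A H ⊆ X := by
  have hD := memG_double hG.1 (omits_double_of_acl_subset hG.1.2 hX)
  refine Set.union_subset hAX (Set.sUnion_subset fun B hB => ?_)
  replace hB : Minimal (fun B' => B' ⊆ H.verts ∧ FreeOver G (A ∪ B') H) B := hB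
  -- By minimality of `B` it suffices that `H` is free over `A ∪ (B ∩ X)`; then `B ⊆ B ∩ X`.
  refine (hB.le_of_le (y := B ∩ X) ⟨Set.inter_subset_left.trans hB.prop.1, ?_⟩
    Set.inter_subset_left).trans Set.inter_subset_right
  have hZ : A ∪ B ∩ X ⊆ H.verts := Set.union_subset hA (Set.inter_subset_left.trans hB.prop.1)
  refine freeOver_of_avoiding hH hZ fun S hS hSZ => ?_
  have := hH.to_subtype
  have := hS.to_subtype
  have := (hH.subset hZ).to_subtype
  obtain ⟨f, hfZ, hfS⟩ := hB.prop.2.exists_avoiding hS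
  obtain ⟨n, ⟨e⟩⟩ := Finite.exists_equiv_fin H.verts
  have key := hG.reflect hD (inclusion G X false) (α := ↥(A ∪ B ∩ X) ⊕ S)
    (v := Sum.elim Subtype.val Subtype.val) (P := fun W K v => ∃ w : Fin n → W,
      Function.Injective w ∧ (∀ x y : H.verts, H.coe.Adj x y → K.Adj (w (e x)) (w (e y))) ∧
      (∀ z : ↥(A ∪ B ∩ X), v (Sum.inl z) = w (e ⟨z.1, hZ z.2⟩)) ∧
      ∀ s i, v (Sum.inr s) ≠ w i) ?_ ?_
  · obtain ⟨w, hinj, hadj, hwZ, hwS⟩ := key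
    refine ⟨⟨⟨w ∘ e, fun {x y} => hadj x y⟩, hinj.comp e.injective⟩,
      fun x hx => (hwZ ⟨x, hx⟩).symm, ?_⟩
    rw [Set.disjoint_left]
    rintro _ ⟨x, rfl⟩ hs
    exact hwS ⟨_, hs⟩ (e x) rfl
  · refine ExPred.exists_family (P := fun W K (v : (↥(A ∪ B ∩ X) ⊕ S) ⊕ Fin n → W) =>
      Function.Injective (v ∘ Sum.inr) ∧
      (∀ x y : H.verts, H.coe.Adj x y → K.Adj (v (Sum.inr (e x))) (v (Sum.inr (e y)))) ∧
      (∀ z : ↥(A ∪ B ∩ X), v (Sum.inl (Sum.inl z)) = v (Sum.inr (e ⟨z.1, hZ z.2⟩))) ∧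
      ∀ s i, v (Sum.inl (Sum.inr s)) ≠ v (Sum.inr i)) (.of_pattern ?_)
    rintro W K v W' K' v' h ⟨h₁, h₂, h₃, h₄⟩
    exact ⟨fun i j hij => h₁ ((h.eq_iff _ _).2 hij), fun x y hxy => (h.adj_iff _ _).1 (h₂ x y hxy),
      fun z => (h.eq_iff _ _).1 (h₃ z), fun s i hs => h₄ s i ((h.eq_iff _ _).2 hs)⟩
  -- The copy `f` over `A ∪ B` is placed in the second copy of `G`, while `S` sits in the first. A
  -- common point lies in `X` and in `A ∪ B`, hence in `A ∪ (B ∩ X)`, which is disjoint from `S`.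
  · refine ⟨fun i => inclusion G X true (f (e.symm i)), ?_, fun x y hxy => ?_, fun z => ?_,
      fun s i hs => ?_⟩
    · exact (inclusion G X true).injective.comp (f.injective.comp e.symm.injective)
    · simp only [Equiv.symm_apply_apply]
      exact (inclusion G X true).map_adj_iff.2 (f.toHom.map_adj hxy)
    · have hz : f ⟨z.1, hZ z.2⟩ = z.1 :=
        hfZ ⟨z.1, hZ z.2⟩ (Set.union_subset_union_right A Set.inter_subset_left z.2)
      change inclusion G X false z.1 = inclusion G X true (f (e.symm (e ⟨z.1, hZ z.2⟩)))
      rw [Equiv.symm_apply_apply, hz]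
      exact double_ext rfl (z.2.elim (fun h => hAX h) fun h => h.2)
    · have hfs : s.1 = f (e.symm i) := congrArg (fun p : DoubleVert X => p.1.1) hs
      have hsX : s.1 ∈ X := by
        by_contra hsX
        have h₁ : inclusion G X false s.1 ∈ side X false := inclusion_mem_side _ _
        have h₂ : inclusion G X false s.1 ∈ side X true := by
          change inclusion G X false s.1 = _ at hs
          rw [hs]
          exact inclusion_mem_side _ _
        rw [mem_side_iff_of_fst_notMem hsX] at h₁ h₂
        rw [h₁] at h₂
        exact absurd h₂ (by simp)
      have hsAB : s.1 ∈ A ∪ B := hfS ⟨⟨_, hfs.symm⟩, s.2⟩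
      exact Set.disjoint_left.1 hSZ s.2 (hsAB.imp id fun h => ⟨h, hsX⟩)

/-! ### Solid graphs -/

section Solid

variable {N : Type*} {C : SimpleGraph N}

theorem reachable_induce_induce {S : Set N} {z : S} {u v : N} (w : C.Walk u v)
    (hS : ∀ x ∈ w.support, x ∈ S) (hz : ∀ x ∈ w.support, x ≠ z) (hu : u ∈ S) (hv : v ∈ S)
    (hu' : (⟨u, hu⟩ : S) ∈ ({z}ᶜ : Set S)) (hv' : (⟨v, hv⟩ : S) ∈ ({z}ᶜ : Set S)) :
    ((C.induce S).induce {z}ᶜ).Reachable ⟨⟨u, hu⟩, hu'⟩ ⟨⟨v, hv⟩, hv'⟩ := by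
  induction w with
  | nil => exact .rfl
  | @cons u x v h w ih =>
    have hxm : x ∈ (SimpleGraph.Walk.cons h w).support := by simp
    have hx : x ∈ S := hS x hxm
    have hx' : (⟨x, hx⟩ : S) ∈ ({z}ᶜ : Set S) := fun h => hz x hxm (congrArg Subtype.val h)
    refine SimpleGraph.Reachable.trans (SimpleGraph.Adj.reachable ?_)
      (ih (fun y hy => hS y (by simp [hy])) (fun y hy => hz y (by simp [hy])) hx hv hx' hv')
    exact h

/-- A cycle induces a 2-connected subgraph. -/
theorem twoConnected_induce_cycle {q x y : N} (hqx : C.Adj q x) (hqy : C.Adj q y) (hxy : x ≠ y)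
    {w : C.Walk x y} (hw : w.IsPath) (hq : q ∉ w.support) :
    TwoConnected (C.induce {v | v = q ∨ v ∈ w.support}) := by
  set S : Set N := {v | v = q ∨ v ∈ w.support}
  have hqS : q ∈ S := Or.inl rfl
  have hxS : x ∈ S := Or.inr w.start_mem_support
  have hyS : y ∈ S := Or.inr w.end_mem_support
  have hdel : ∀ z : S, ((C.induce S).induce {z}ᶜ).Connected := by
    rintro ⟨z, hz⟩
    rw [SimpleGraph.connected_iff_exists_forall_reachable]
    rcases hz with rfl | hzw
    · refine ⟨⟨⟨x, hxS⟩, fun h => hqx.ne' (congrArg Subtype.val h)⟩, ?_⟩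
      rintro ⟨⟨v, hv⟩, hvz⟩
      have hvw : v ∈ w.support := hv.resolve_left fun h => hvz (Subtype.ext h)
      obtain ⟨p, r, rfl⟩ := w.mem_support_iff_exists_append.1 hvw
      refine reachable_induce_induce p (fun u hu => Or.inr ?_) (fun u hu huz => hq ?_) _ _ _ _
      · exact (SimpleGraph.Walk.mem_support_append_iff _ _).2 (Or.inl hu)
      · rw [← show u = z from huz]
        exact (SimpleGraph.Walk.mem_support_append_iff _ _).2 (Or.inl hu)
    · have hzq : q ≠ z := fun h => hq (h ▸ hzw)
      refine ⟨⟨⟨q, hqS⟩, fun h => hzq (congrArg Subtype.val h)⟩, ?_⟩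
      rintro ⟨⟨v, hv⟩, hvz⟩
      have hvz' : v ≠ z := fun h => hvz (Subtype.ext h)
      rcases hv with rfl | hvw
      · exact .rfl
      obtain ⟨p, r, rfl⟩ := w.mem_support_iff_exists_append.1 hvw
      -- The deleted vertex `z` lies on at most one of the two arcs of the cycle from `q` to `v`;
      -- the other arc connects them.
      by_cases hzp : z ∈ p.support
      · have hzr : z ∉ r.support := fun h =>
          SimpleGraph.Walk.IsPath.ne_of_mem_support_of_append hw hvz'.symm hzp h rfl
        refine reachable_induce_induce (.cons hqy r.reverse) (fun u hu => ?_) (fun u hu huz => ?_)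
          _ _ _ _
        · rcases List.mem_cons.1 hu with rfl | hu
          · exact hqS
          · exact Or.inr ((SimpleGraph.Walk.mem_support_append_iff _ _).2 (Or.inr (by simpa using hu)))
        · rcases List.mem_cons.1 hu with rfl | hu
          · exact hzq huz
          · exact hzr (by rw [← show u = z from huz]; simpa using hu)
      · refine reachable_induce_induce (.cons hqx p) (fun u hu => ?_) (fun u hu huz => ?_) _ _ _ _
        · rcases List.mem_cons.1 hu with rfl | hu
          · exact hqS
          · exact Or.inr ((SimpleGraph.Walk.mem_support_append_iff _ _).2 (Or.inl hu))
        · rcases List.mem_cons.1 hu with rfl | hu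
          · exact hzq huz
          · exact hzp (by rw [← show u = z from huz]; exact hu)
  refine ⟨?_, ?_, hdel⟩
  · have h₁ : ({q, x, y} : Set N).encard = 3 :=
      Set.encard_eq_three.2 ⟨q, x, y, hqx.ne, hqy.ne, hxy, rfl⟩
    have h₂ : ({q, x, y} : Set N) ⊆ S := by
      rintro _ (rfl | rfl | rfl) <;> assumption
    exact h₁ ▸ Set.encard_le_encard h₂
  · rw [SimpleGraph.connected_iff_exists_forall_reachable]
    refine ⟨⟨x, hxS⟩, ?_⟩
    rintro ⟨v, hv⟩
    by_cases hvq : v = q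
    · subst hvq
      exact SimpleGraph.Adj.reachable (show (C.induce S).Adj ⟨x, hxS⟩ ⟨v, hv⟩ from hqx.symm)
    · have hc := (hdel ⟨q, hqS⟩).preconnected
        ⟨⟨x, hxS⟩, fun h => hqx.ne' (congrArg Subtype.val h)⟩
        ⟨⟨v, hv⟩, fun h => hvq (congrArg Subtype.val h)⟩
      exact hc.map (SimpleGraph.Embedding.induce _).toHom

/-- In a solid graph two neighbours of `q` that are connected in the complement of `q` are
adjacent. -/
theorem Solid.adj_of_reachable (hC : Solid C) {q x y : N} (hqx : C.Adj q x) (hqy : C.Adj q y)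
    (hxy : x ≠ y) {hx : x ∈ ({q}ᶜ : Set N)} {hy : y ∈ ({q}ᶜ : Set N)}
    (h : (C.induce {q}ᶜ).Reachable ⟨x, hx⟩ ⟨y, hy⟩) : C.Adj x y := by
  -- A path from `x` to `y` that avoids `q` closes up through `q` to a cycle, which induces a
  -- 2-connected, hence complete, subgraph.
  obtain ⟨p, hp⟩ := h.exists_isPath
  have hinj : Function.Injective (SimpleGraph.Embedding.induce (G := C) {q}ᶜ).toHom :=
    (SimpleGraph.Embedding.induce (G := C) {q}ᶜ).injective
  have hsup : ∀ v ∈ (p.map (SimpleGraph.Embedding.induce {q}ᶜ).toHom).support, v ≠ q := by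
    intro v hv
    rw [SimpleGraph.Walk.support_map, List.mem_map] at hv
    obtain ⟨⟨z, hz⟩, -, rfl⟩ := hv
    exact hz
  obtain ⟨w, hw, hq⟩ : ∃ w : C.Walk x y, w.IsPath ∧ q ∉ w.support :=
    ⟨p.map (SimpleGraph.Embedding.induce {q}ᶜ).toHom, SimpleGraph.Walk.IsPath.map hinj hp,
      fun h => hsup q h rfl⟩
  have := hC _ (twoConnected_induce_cycle hqx hqy hxy hw hq)
  have hadj : (C.induce {v | v = q ∨ v ∈ w.support}).Adj ⟨x, Or.inr w.start_mem_support⟩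
      ⟨y, Or.inr w.end_mem_support⟩ := by
    rw [this, SimpleGraph.top_adj]
    exact fun h => hxy (congrArg Subtype.val h)
  exact hadj

/-- The vertices of a component of the complement of a vertex. -/
def branchVerts {a : N} (K : (C.induce {a}ᶜ).ConnectedComponent) : Set N :=
  Subtype.val '' K.supp

theorem notMem_branchVerts {a : N} (K : (C.induce {a}ᶜ).ConnectedComponent) :
    a ∉ branchVerts K := by
  rintro ⟨⟨z, hz⟩, -, hza⟩
  exact hz hza

theorem branchVerts_adj {a : N} {K : (C.induce {a}ᶜ).ConnectedComponent} {u v : N}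
    (hu : u ∈ branchVerts K) (h : C.Adj u v) (hv : v ≠ a) : v ∈ branchVerts K := by
  obtain ⟨u, hu, rfl⟩ := hu
  exact ⟨⟨v, hv⟩, K.mem_supp_of_adj_mem_supp hu h, rfl⟩

theorem branchVerts_reachable {a : N} {K : (C.induce {a}ᶜ).ConnectedComponent} {u v : N}
    (hu : u ∈ branchVerts K) (hv : v ∈ branchVerts K) :
    ∃ hu' hv', (C.induce {a}ᶜ).Reachable ⟨u, hu'⟩ ⟨v, hv'⟩ := by
  obtain ⟨⟨u, hu'⟩, hu, rfl⟩ := hu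
  obtain ⟨⟨v, hv'⟩, hv, rfl⟩ := hv
  exact ⟨hu', hv', SimpleGraph.ConnectedComponent.exact (hu.trans hv.symm)⟩

theorem exists_mem_branchVerts {a v : N} (h : v ≠ a) :
    ∃ K : (C.induce {a}ᶜ).ConnectedComponent, v ∈ branchVerts K :=
  ⟨(C.induce {a}ᶜ).connectedComponentMk ⟨v, h⟩, ⟨v, h⟩, rfl, rfl⟩

theorem Solid.adj_of_mem_branchVerts (hC : Solid C) {a x y : N}
    {K : (C.induce {a}ᶜ).ConnectedComponent} (hx : x ∈ branchVerts K) (hy : y ∈ branchVerts K)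
    (hax : C.Adj a x) (hay : C.Adj a y) (hxy : x ≠ y) : C.Adj x y := by
  obtain ⟨hx', hy', h⟩ := branchVerts_reachable hx hy
  exact hC.adj_of_reachable hax hay hxy h

/-- A vertex of a branch at `a` not adjacent to `a` is separated from `a` by a neighbour of `a`
in the branch. -/
theorem Solid.exists_separating (hC : Solid C) (hconn : C.Connected) {a v : N}
    {K : (C.induce {a}ᶜ).ConnectedComponent} (hv : v ∈ branchVerts K) (hav : ¬ C.Adj a v) :
    ∃ q ∈ branchVerts K, C.Adj a q ∧ ∃ L : (C.induce {q}ᶜ).ConnectedComponent,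
      v ∈ branchVerts L ∧ a ∉ branchVerts L := by
  -- The separating vertex `q` is the second vertex of a shortest walk from `a` to `v`. If `a` were
  -- in the branch of `v` at `q`, solidity would join `a` to the third vertex `x` and shorten the
  -- walk.
  obtain ⟨w, hw⟩ := hconn.exists_walk_length_eq_dist a v
  have hpath := w.isPath_of_length_eq_dist hw
  match w, hw, hpath with
  | .nil, _, _ => exact absurd hv (notMem_branchVerts K)
  | .cons h .nil, _, _ => exact absurd h hav
  | .cons (v := q) haq (.cons (v := x) hqx p), hw, hpath =>
    have hpath' := SimpleGraph.Walk.cons_isPath_iff _ _ |>.1 hpath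
    have hpath'' := SimpleGraph.Walk.cons_isPath_iff _ _ |>.1 hpath'.1
    have key : ∀ {s t r : N} (w : C.Walk s t), r ∉ w.support → ∀ (hs : s ∈ ({r}ᶜ : Set N))
        (ht : t ∈ ({r}ᶜ : Set N)), (C.induce {r}ᶜ).Reachable ⟨s, hs⟩ ⟨t, ht⟩ := by
      intro s t r w hr hs ht
      exact ⟨w.induce {r}ᶜ fun x hx (hxr : x = r) => hr (hxr ▸ hx)⟩
    have hvq : v ≠ q := fun h => hpath''.2 (h ▸ p.end_mem_support)
    have hva : v ≠ a := fun h => notMem_branchVerts K (h ▸ hv)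
    refine ⟨q, ?_, haq, (C.induce {q}ᶜ).connectedComponentMk ⟨v, hvq⟩,
      ⟨⟨v, hvq⟩, rfl, rfl⟩, ?_⟩
    · obtain ⟨⟨v, hv'⟩, hvK, rfl⟩ := hv
      refine ⟨⟨q, haq.ne'⟩, ?_, rfl⟩
      rw [SimpleGraph.ConnectedComponent.mem_supp_iff] at hvK ⊢
      rw [← hvK, SimpleGraph.ConnectedComponent.eq]
      exact key _ hpath'.2 _ _
    · rintro ⟨⟨b, hb⟩, hbL, hba⟩
      obtain rfl : b = a := hba
      rw [SimpleGraph.ConnectedComponent.mem_supp_iff, SimpleGraph.ConnectedComponent.eq] at hbL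
      have hxq : x ∈ ({q}ᶜ : Set N) := hqx.ne'
      have hxv := key p hpath''.2 hxq hvq
      have hbx : b ≠ x := fun h => hpath'.2 (by simp [h])
      have hadj := hC.adj_of_reachable haq.symm hqx hbx (hbL.trans hxv.symm)
      have := SimpleGraph.dist_le (SimpleGraph.Walk.cons hadj p)
      simp only [SimpleGraph.Walk.length_cons] at this hw
      omega

/-- The branch at a vertex `q` of a branch at `a` that does not contain `a` is contained in it. -/
theorem branchVerts_ssubset {a q v : N} {K : (C.induce {a}ᶜ).ConnectedComponent}
    {L : (C.induce {q}ᶜ).ConnectedComponent} (hq : q ∈ branchVerts K) (hvK : v ∈ branchVerts K)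
    (hvL : v ∈ branchVerts L) (haL : a ∉ branchVerts L) : branchVerts L ⊂ branchVerts K := by
  refine ⟨fun u hu => ?_, fun h => notMem_branchVerts L (h hq)⟩
  obtain ⟨hv', hu', ⟨w⟩⟩ := branchVerts_reachable hvL hu
  -- A walk inside `L` never meets `a`, so it cannot leave `K`.
  have key : ∀ (s t : ({q}ᶜ : Set N)) (w : (C.induce {q}ᶜ).Walk s t), (s : N) ∈ branchVerts L →
      (s : N) ∈ branchVerts K → (t : N) ∈ branchVerts K := by
    intro s t w
    induction w with
    | nil => exact fun _ h => h
    | @cons s r t hsr w ih =>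
      intro hsL hsK
      have hrL : (r : N) ∈ branchVerts L := branchVerts_adj hsL hsr r.2
      exact ih hrL (branchVerts_adj hsK hsr fun h => haL (h ▸ hrL))
  exact key _ _ w hvL hvK

end Solid

/-! ### Moving branches of a solid graph between the copies of an amalgam -/

section Move

variable {N : Type*} {C : SimpleGraph N} {V : Type u} {G : SimpleGraph V} {X : Set V}

/-- Proper branches of `C` attached to `X` have copies in `G` that avoid finite sets, except for
points of `X` they contain already. -/
def Movable (C : SimpleGraph N) (G : SimpleGraph V) (X : Set V) : Prop :=
  ∀ (a : N) (K : (C.induce {a}ᶜ).ConnectedComponent), insert a (branchVerts K) ≠ Set.univ →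
    ∀ e : N → V, Set.InjOn e (insert a (branchVerts K)) →
      (∀ u ∈ insert a (branchVerts K), ∀ v ∈ insert a (branchVerts K), C.Adj u v →
        G.Adj (e u) (e v)) → e a ∈ X → ∀ S : Set V, S.Finite →
      ∃ e' : N → V, Set.InjOn e' (insert a (branchVerts K)) ∧
        (∀ u ∈ insert a (branchVerts K), ∀ v ∈ insert a (branchVerts K), C.Adj u v →
          G.Adj (e' u) (e' v)) ∧ e' a = e a ∧
        ∀ v ∈ branchVerts K, e' v ∈ S → e' v ∈ X ∧ ∃ k ∈ branchVerts K, e k = e' v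

/-- No edge of the amalgam joins different copies outside `X`, so one clique vertex outside `X`
decides the copy for all others. -/
theorem exists_side_of_clique {g : N → DoubleVert X}
    (hadj : ∀ u v, C.Adj u v → (double G X).Adj (g u) (g v)) {Q : Set N}
    (hQ : ∀ u ∈ Q, ∀ v ∈ Q, u ≠ v → C.Adj u v) : ∃ j, ∀ q ∈ Q, g q ∈ side X j := by
  by_cases h : ∀ q ∈ Q, (g q).1.1 ∈ X
  · exact ⟨true, fun q hq => Or.inl (h q hq)⟩
  · push Not at h
    obtain ⟨q, hq, hqX⟩ := h
    refine ⟨(g q).1.2, fun r hr => ?_⟩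
    by_cases hqr : q = r
    · exact hqr ▸ Or.inr rfl
    · exact double_adj_mem_side (hadj q r (hQ q hq r hr hqr)) (Or.inr rfl) hqX

theorem mem_of_mem_side_of_ne {p : DoubleVert X} {i j : Bool} (hi : p ∈ side X i)
    (hj : p ∈ side X j) (hij : i ≠ j) : p.1.1 ∈ X := by
  by_contra h
  rw [mem_side_iff_of_fst_notMem h] at hi hj
  exact hij (hi.symm.trans hj)

/-- A branch whose root lies in the copy number `i` can be moved into that copy. -/
theorem exists_move [Finite N] (hsolid : Solid C) (hconn : C.Connected) (hfree : C.Free G)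
    (hmov : Movable C G X) (n : ℕ) : ∀ (a : N) (K : (C.induce {a}ᶜ).ConnectedComponent),
    (branchVerts K).ncard ≤ n → ∀ g : N → DoubleVert X, Function.Injective g →
      (∀ u v, C.Adj u v → (double G X).Adj (g u) (g v)) → ∀ i, g a ∈ side X i →
      ∃ g' : N → DoubleVert X, Function.Injective g' ∧
        (∀ u v, C.Adj u v → (double G X).Adj (g' u) (g' v)) ∧
        (∀ v ∉ branchVerts K, g' v = g v) ∧ ∀ v ∈ branchVerts K, g' v ∈ side X i := by
  classical
  induction n with
  | zero =>
    intro a K hK g hinj hadj i hi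
    rw [Nat.le_zero, Set.ncard_eq_zero] at hK
    exact ⟨g, hinj, hadj, fun _ _ => rfl, by simp [hK]⟩
  | succ n ih =>
    intro a K hK g hinj hadj i hi
    let Q : Set N := insert a {q | q ∈ branchVerts K ∧ C.Adj a q}
    have hQ : ∀ u ∈ Q, ∀ v ∈ Q, u ≠ v → C.Adj u v := by
      rintro u (rfl | hu) v (rfl | hv) huv
      · exact absurd rfl huv
      · exact hv.2
      · exact hu.2.symm
      · exact hsolid.adj_of_mem_branchVerts hu.1 hv.1 hu.2 hv.2 huv
    obtain ⟨j, hj⟩ := exists_side_of_clique hadj hQ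
    -- gather the branch in copy `j`, where its vertices adjacent to the root lie
    obtain ⟨g₁, hinj₁, hadj₁, hoff₁, hside₁⟩ : ∃ g' : N → DoubleVert X, Function.Injective g' ∧
        (∀ u v, C.Adj u v → (double G X).Adj (g' u) (g' v)) ∧
        (∀ v ∉ branchVerts K, g' v = g v) ∧ ∀ v ∈ branchVerts K, g' v ∈ side X j := by
      -- Among the maps that keep the clique `Q` in copy `j`, one with the fewest vertices outside
      -- that copy is taken. A remaining bad vertex lies in a strictly smaller branch rooted at some
      -- `q ∈ Q`, which the induction hypothesis moves into copy `j`.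
      let 𝒮 : Set (N → DoubleVert X) := {g' | Function.Injective g' ∧
        (∀ u v, C.Adj u v → (double G X).Adj (g' u) (g' v)) ∧
        (∀ v ∉ branchVerts K, g' v = g v) ∧ ∀ q ∈ Q, g' q ∈ side X j}
      obtain ⟨g₁, ⟨h₁, h₂, h₃, h₄⟩, hmin⟩ := (measure fun g' : N → DoubleVert X =>
        {v | g' v ∉ side X j}.ncard).wf.has_min 𝒮 ⟨g, hinj, hadj, fun _ _ => rfl, hj⟩
      refine ⟨g₁, h₁, h₂, h₃, fun v hv => ?_⟩
      by_contra hbad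
      have hav : ¬ C.Adj a v := fun h => hbad (h₄ v (Or.inr ⟨hv, h⟩))
      obtain ⟨q, hqK, haq, L, hvL, haL⟩ := hsolid.exists_separating hconn hv hav
      have hLK := branchVerts_ssubset hqK hv hvL haL
      have hcard := Set.ncard_lt_ncard hLK
      obtain ⟨g₂, h₁', h₂', h₃', h₄'⟩ := ih q L (by omega) g₁ h₁ h₂ j (h₄ q (Or.inr ⟨hqK, haq⟩))
      have hkeep : ∀ u, g₁ u ∈ side X j → g₂ u ∈ side X j := fun u hu => by
        by_cases huL : u ∈ branchVerts L
        · exact h₄' u huL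
        · rwa [h₃' u huL]
      refine hmin g₂ ⟨h₁', h₂', fun u hu => ?_, fun u hu => hkeep u (h₄ u hu)⟩ ?_
      · rw [h₃' u fun h => hu (hLK.1 h), h₃ u hu]
      · refine Set.ncard_lt_ncard ⟨fun u hu hu' => hu (hkeep u hu'), fun h => ?_⟩
        exact h hbad (h₄' v hvL)
    by_cases hij : i = j
    · exact hij ▸ ⟨g₁, hinj₁, hadj₁, hoff₁, hside₁⟩
    have haj : g₁ a ∈ side X j := by
      rw [hoff₁ a (notMem_branchVerts K)]
      exact hj a (Or.inl rfl)
    have hall : ∀ v ∈ insert a (branchVerts K), g₁ v ∈ side X j := by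
      rintro v (rfl | hv)
      · exact haj
      · exact hside₁ v hv
    have haX : (g₁ a).1.1 ∈ X := by
      refine mem_of_mem_side_of_ne ?_ haj hij
      rwa [hoff₁ a (notMem_branchVerts K)]
    have hproper : insert a (branchVerts K) ≠ Set.univ := fun h =>
      hfree (isContained_of_forall_mem_side hinj₁ hadj₁ fun v => hall v (h ▸ Set.mem_univ v))
    obtain ⟨e, heinj, headj, hea, heS⟩ := hmov a K hproper (fun v => (g₁ v).1.1)
      (fun u hu v hv huv => hinj₁ (by
        rw [← inclusion_of_mem_side (G := G) (hall u hu),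
          ← inclusion_of_mem_side (G := G) (hall v hv)]
        exact congrArg _ huv))
      (fun u _ v _ huv => (hadj₁ u v huv).1) haX (Set.range fun v => (g₁ v).1.1)
      (Set.finite_range _)
    let g₂ : N → DoubleVert X := fun v => if v ∈ branchVerts K then inclusion G X i (e v) else g₁ v
    have hg₂ : ∀ v ∈ branchVerts K, g₂ v = inclusion G X i (e v) := fun v hv => if_pos hv
    have hg₂' : ∀ v ∉ branchVerts K, g₂ v = g₁ v := fun v hv => if_neg hv
    have hg₂a : g₂ a = inclusion G X i (e a) := by
      rw [hg₂' a (notMem_branchVerts K)]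
      exact double_ext hea.symm haX
    have hg₂K : ∀ v ∈ insert a (branchVerts K), g₂ v = inclusion G X i (e v) := by
      rintro v (rfl | hv)
      · exact hg₂a
      · exact hg₂ v hv
    -- A collision with an old vertex `v` occurs only at a point of `X` that `g₁` already gives to
    -- some `k ∈ K`; injectivity of `g₁` then puts `v` in `K`.
    have hne : ∀ u ∈ branchVerts K, ∀ v ∉ branchVerts K, g₂ u ≠ g₂ v := by
      intro u hu v hv huv
      rw [hg₂ u hu, hg₂' v hv] at huv
      have h₁ : e u = (g₁ v).1.1 := congrArg (fun p : DoubleVert X => p.1.1) huv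
      obtain ⟨heX, k, hk, hke⟩ := heS u hu ⟨v, h₁.symm⟩
      have hkv : g₁ k = g₁ v := double_ext (hke.trans h₁) (by rw [hke]; exact heX)
      exact hv (hinj₁ hkv ▸ hk)
    have hadjK : ∀ u ∈ branchVerts K, ∀ v, C.Adj u v → (double G X).Adj (g₂ u) (g₂ v) := by
      intro u hu v huv
      have hv : v ∈ insert a (branchVerts K) := by
        by_cases hva : v = a
        · exact Or.inl hva
        · exact Or.inr (branchVerts_adj hu huv hva)
      rw [hg₂ u hu, hg₂K v hv]
      exact (inclusion G X i).map_adj_iff.2 (headj u (Or.inr hu) v hv huv)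
    refine ⟨g₂, fun u v huv => ?_, fun u v huv => ?_, fun v hv => ?_, fun v hv => ?_⟩
    · by_cases hu : u ∈ branchVerts K <;> by_cases hv : v ∈ branchVerts K
      · rw [hg₂ u hu, hg₂ v hv] at huv
        exact heinj (Or.inr hu) (Or.inr hv) ((inclusion G X i).injective huv)
      · exact absurd huv (hne u hu v hv)
      · exact absurd huv.symm (hne v hv u hu)
      · rw [hg₂' u hu, hg₂' v hv] at huv
        exact hinj₁ huv
    · by_cases hu : u ∈ branchVerts K
      · exact hadjK u hu v huv
      by_cases hv : v ∈ branchVerts K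
      · exact (hadjK v hv u huv.symm).symm
      · rw [hg₂' u hu, hg₂' v hv]
        exact hadj₁ u v huv
    · rw [hg₂' v hv, hoff₁ v hv]
    · rw [hg₂ v hv]
      exact inclusion_mem_side _ _

/-- A solid connected graph with movable branches that is contained in the amalgam is contained
in `G`. -/
theorem free_double [Finite N] (hsolid : Solid C) (hconn : C.Connected) (hfree : C.Free G)
    (hmov : Movable C G X) : C.Free (double G X) := by
  rintro ⟨g⟩
  obtain ⟨a⟩ := hconn.nonempty
  obtain ⟨i, hi⟩ : ∃ i, g a ∈ side X i := ⟨_, Or.inr rfl⟩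
  -- With the number of vertices outside the copy of `a` minimal, none is left: moving the branch at
  -- `a` of a stray vertex would lower the number.
  let 𝒮 : Set (N → DoubleVert X) := {g' | Function.Injective g' ∧
    (∀ u v, C.Adj u v → (double G X).Adj (g' u) (g' v)) ∧ g' a ∈ side X i}
  obtain ⟨g₁, ⟨h₁, h₂, h₃⟩, hmin⟩ := (measure fun g' : N → DoubleVert X =>
    {v | g' v ∉ side X i}.ncard).wf.has_min 𝒮
      ⟨g, g.injective, fun u v h => g.toHom.map_adj h, hi⟩
  refine hfree (isContained_of_forall_mem_side h₁ h₂ (i := i) fun v => ?_)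
  by_contra hbad
  have hva : v ≠ a := fun h => hbad (h ▸ h₃)
  obtain ⟨K, hK⟩ := exists_mem_branchVerts (C := C) hva
  obtain ⟨g₂, h₁', h₂', h₃', h₄'⟩ := exists_move hsolid hconn hfree hmov _ a K le_rfl g₁ h₁ h₂ i h₃
  have hkeep : ∀ u, g₁ u ∈ side X i → g₂ u ∈ side X i := fun u hu => by
    by_cases huK : u ∈ branchVerts K
    · exact h₄' u huK
    · rwa [h₃' u huK]
  refine hmin g₂ ⟨h₁', h₂', hkeep a h₃⟩ ?_
  refine Set.ncard_lt_ncard ⟨fun u hu hu' => hu (hkeep u hu'), fun h => ?_⟩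
  exact h hbad (h₄' v hK)

end Move

/-! ### Closed sets have movable branches -/

theorem exists_pair_iso {N : Type*} [Finite N] {C : SimpleGraph N} (H : C.Subgraph) (a : N)
    (ha : a ∈ H.verts) : ∃ p : GraphPair, IsoPair {a} H p := by
  obtain ⟨m, ⟨e⟩⟩ := Finite.exists_equiv_fin H.verts
  refine ⟨⟨m, H.coe.map e, {i | (e.symm i : N) = a}⟩, by simpa using ha,
    SimpleGraph.Iso.map e H.coe, fun x => ?_⟩
  change (x : N) = a ↔ (e.symm (e x) : N) = a
  rw [Equiv.symm_apply_apply]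

/-- The subgraph induced on a branch and its root is a branch in the sense of `IsBranch`. -/
theorem isBranch_induce {N : Type*} {C : SimpleGraph N} {a : N}
    (K : (C.induce {a}ᶜ).ConnectedComponent) (h : insert a (branchVerts K) ≠ Set.univ) :
    IsBranch C a ((⊤ : C.Subgraph).induce (insert a (branchVerts K))) := by
  refine ⟨fun h' => h (congrArg SimpleGraph.Subgraph.verts h'), Or.inl rfl, K, ?_⟩
  have ha := notMem_branchVerts K
  refine SimpleGraph.Subgraph.ext ?_ ?_
  · change insert a (branchVerts K) \ {a} = branchVerts K
    simp [ha]
  · ext u v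
    rw [SimpleGraph.Subgraph.deleteVerts_adj]
    change (u ∈ insert a (branchVerts K) ∧ u ∉ ({a} : Set N) ∧ v ∈ insert a (branchVerts K) ∧
      v ∉ ({a} : Set N) ∧ (u ∈ insert a (branchVerts K) ∧ v ∈ insert a (branchVerts K) ∧
      C.Adj u v)) ↔ (u ∈ branchVerts K ∧ v ∈ branchVerts K ∧ C.Adj u v)
    simp only [Set.mem_insert_iff, Set.mem_singleton_iff]
    constructor
    · tauto
    · rintro ⟨hu, hv, huv⟩
      have hua : u ≠ a := fun h => ha (h ▸ hu)
      have hva : v ≠ a := fun h => ha (h ▸ hv)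
      tauto

/-- The image `H` of a branch is free over `{e a} ∪ B` for some `B ⊆ X` inside `H`. Some copy
therefore meets `S` only in `{e a} ∪ B`, and points of `B` other than `e a` are images of branch
vertices. -/
theorem movable_of_clFam_subset {𝒞 : Set FinGraph} {V : Type u} {G : SimpleGraph V} {X : Set V}
    (hX : clFam G (inducedBranchPairs 𝒞) X ⊆ X) {C : FinGraph} (hC : C ∈ 𝒞) :
    Movable C.graph G X := by
  classical
  intro a K hK e hinj hadj haX S hS
  let B₀ := (⊤ : C.graph.Subgraph).induce (insert a (branchVerts K))
  obtain ⟨p, hp⟩ := exists_pair_iso B₀ a (Or.inl rfl)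
  have hpmem : p ∈ inducedBranchPairs 𝒞 :=
    ⟨C, hC, a, B₀, isBranch_induce K hK, fun _ hu _ hv huv => ⟨hu, hv, huv⟩, hp⟩
  let f : B₀.coe.Copy G := ⟨⟨fun v => e v, fun {u v} huv => hadj u u.2 v v.2 huv.2.2⟩,
    fun u v huv => Subtype.ext (hinj u.2 v.2 huv)⟩
  let H := f.toSubgraph
  let φ : B₀.coe ≃g H.coe := f.isoToSubgraph
  have hφ : ∀ v, (φ v : V) = e v := fun _ => rfl
  have hfin : Finite H.verts := Finite.of_equiv _ φ.toEquiv
  have hA : {e a} ⊆ H.verts := by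
    rintro _ rfl
    exact (φ ⟨a, Or.inl rfl⟩).2
  have hiso : IsoPair {e a} H p := by
    obtain ⟨-, ψ, hψ⟩ := hp
    refine ⟨hA, φ.symm.trans ψ, fun x => ?_⟩
    obtain ⟨y, rfl⟩ := φ.surjective x
    have : (φ.symm.trans ψ) (φ y) = ψ y := by simp
    rw [this, ← hψ, hφ]
    exact ⟨fun h => hinj y.2 (Or.inl rfl) h, fun h => congrArg e h⟩
  have hcl : cl G {e a} H ⊆ X := fun y hy =>
    hX (Or.inr ⟨{e a}, H, by simpa using haX, ⟨p, hpmem, hiso⟩, hy⟩)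
  obtain ⟨B, hBX, hBH, hB⟩ := exists_freeOver_of_cl_subset (Set.toFinite _) hA hcl
  obtain ⟨k, hkB, hkS⟩ := hB.exists_avoiding hS
  let e' : Fin C.order → V := fun v =>
    if h : v ∈ insert a (branchVerts K) then k (φ ⟨v, h⟩) else e v
  have he' : ∀ v (h : v ∈ insert a (branchVerts K)), e' v = k (φ ⟨v, h⟩) := fun v h => dif_pos h
  have ha' : e' a = e a := by
    rw [he' a (Or.inl rfl)]
    exact hkB _ (Or.inl (hφ _))
  have hinj' : Set.InjOn e' (insert a (branchVerts K)) := by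
    intro u hu v hv huv
    rw [he' u hu, he' v hv] at huv
    exact congrArg Subtype.val (φ.injective (k.injective huv))
  refine ⟨e', hinj', fun u hu v hv huv => ?_, ha', fun v hv hvS => ?_⟩
  · rw [he' u hu, he' v hv]
    exact k.toHom.map_adj (φ.map_adj_iff.2 ⟨hu, hv, huv⟩)
  · have hvB : e' v ∈ {e a} ∪ B := by
      refine hkS ⟨?_, hvS⟩
      rw [he' v (Or.inr hv)]
      exact ⟨_, rfl⟩
    have hva : e' v ≠ e a := fun h =>
      notMem_branchVerts K (hinj' (Or.inr hv) (Or.inl rfl) (h.trans ha'.symm) ▸ hv)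
    have hvB' : e' v ∈ B := hvB.resolve_left hva
    refine ⟨hBX hvB', ?_⟩
    obtain ⟨⟨u, hu⟩, hue⟩ := φ.surjective ⟨e' v, hBH hvB'⟩
    have hue' : e u = e' v := (hφ ⟨u, hu⟩).symm.trans (congrArg Subtype.val hue)
    rcases hu with rfl | hu
    · exact absurd hue'.symm hva
    · exact ⟨u, hu, hue'⟩

theorem omits_double_of_clFam_subset {𝒞 : Set FinGraph} (hconn : ∀ C ∈ 𝒞, C.graph.Connected)
    (hsolid : ∀ C ∈ 𝒞, Solid C.graph) {V : Type u} {G : SimpleGraph V} (hG : Omits 𝒞 G)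
    {X : Set V} (hX : clFam G (inducedBranchPairs 𝒞) X ⊆ X) : Omits 𝒞 (double G X) :=
  fun C hC => free_double (hsolid C hC) (hconn C hC) (hG C hC) (movable_of_clFam_subset hX hC)

/-! ### Comparison of `clFam` with `acl` -/

theorem IsoPair.finite_verts {V : Type u} {G : SimpleGraph V} {A : Set V} {H : G.Subgraph}
    {p : GraphPair} (h : IsoPair A H p) : H.verts.Finite := by
  obtain ⟨-, e, -⟩ := h
  have : Finite H.verts := Finite.of_equiv _ e.symm.toEquiv
  exact Set.toFinite _

theorem subset_clFam {V : Type u} (G : SimpleGraph V) (F : Set GraphPair) (X : Set V) :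
    X ⊆ clFam G F X := Set.subset_union_left

theorem clFam_mono {V : Type u} (G : SimpleGraph V) {F F' : Set GraphPair} (h : F ⊆ F')
    (X : Set V) : clFam G F X ⊆ clFam G F' X :=
  Set.union_subset_union_right X fun _ ⟨A, H, hA, ⟨p, hp, hiso⟩, hy⟩ =>
    ⟨A, H, hA, ⟨p, h hp, hiso⟩, hy⟩

theorem clFam_subset_of_acl_subset {𝒞 : Set FinGraph} {V : Type u} {G : SimpleGraph V}
    (hG : MemE 𝒞 G) (F : Set GraphPair) {X : Set V} (hX : acl G X ⊆ X) : clFam G F X ⊆ X :=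
  Set.union_subset subset_rfl fun _ ⟨_, _, hA, ⟨_, _, hiso⟩, hy⟩ =>
    cl_subset_of_acl_subset hG hX hiso.finite_verts hiso.1 hA hy

theorem acl_subset_of_clFam_subset {𝒞 : Set FinGraph} (hconn : ∀ C ∈ 𝒞, C.graph.Connected)
    (hsolid : ∀ C ∈ 𝒞, Solid C.graph) {V : Type u} {G : SimpleGraph V} (hG : MemE 𝒞 G)
    {X : Set V} (hX : clFam G (inducedBranchPairs 𝒞) X ⊆ X) : acl G X ⊆ X :=
  acl_subset_of_omits_double hG (omits_double_of_clFam_subset hconn hsolid hG.1.2 hX)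

/-- Any family of finite pairs that includes the induced branches is a base. -/
theorem isBase_of_inducedBranchPairs_subset {𝒞 : Set FinGraph}
    (hconn : ∀ C ∈ 𝒞, C.graph.Connected) (hsolid : ∀ C ∈ 𝒞, Solid C.graph) {V : Type u}
    {G : SimpleGraph V} (hG : MemE 𝒞 G) {F : Set GraphPair} (hF : inducedBranchPairs 𝒞 ⊆ F) :
    IsBase G F := fun X => by
  constructor
  · intro h
    exact (subset_acl G X).antisymm
      (acl_subset_of_clFam_subset hconn hsolid hG ((clFam_mono G hF X).trans h.ge))
  · intro h
    exact (subset_clFam G F X).antisymm (clFam_subset_of_acl_subset hG F h.ge)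

/-! ### Existential types are maximal, and algebraic closure is idempotent -/

open Filter in
/-- In an existentially complete graph, inclusion of existential types implies equality. -/
theorem MemE.exPred_of_forall_imp {𝒞 : Set FinGraph} {V : Type u} {G : SimpleGraph V}
    (hG : MemE 𝒞 G) {α : Type} [Finite α] {b c : α → V}
    (h : ∀ P : ∀ V : Type u, SimpleGraph V → (α → V) → Prop, ExPred P → P V G b → P V G c)
    {P : ∀ V : Type u, SimpleGraph V → (α → V) → Prop} (hP : ExPred P) (hc : P V G c) :
    P V G b := by
  classical
  -- The pattern of `b` together with a finite set `Y` is an existential condition on `b`, so it is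
  -- realized over `c` as well, by `k Y`.
  have hk : ∀ Y : Finset V, ∃ k : V → V, SamePattern G (Sum.elim b (fun y : Y => y.1)) G
      (Sum.elim c (fun y : Y => k y.1)) := by
    intro Y
    obtain ⟨n, ⟨e⟩⟩ := Finite.exists_equiv_fin Y
    obtain ⟨w, hw⟩ := h (fun W H v => ∃ w : Fin n → W,
      SamePattern G (Sum.elim b (fun i => (e.symm i).1)) H (Sum.elim v w))
      (.exists_family (P := fun W H v =>
        SamePattern G (Sum.elim b (fun i => (e.symm i).1)) H v)
        (.of_pattern fun W H v W' H' v' h hv =>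
          ⟨fun i j => (hv.eq_iff i j).trans (h.eq_iff i j),
            fun i j => (hv.adj_iff i j).trans (h.adj_iff i j)⟩))
      ⟨fun i => (e.symm i).1, fun _ _ => Iff.rfl, fun _ _ => Iff.rfl⟩
    refine ⟨fun y => if hy : y ∈ Y then w (e ⟨y, hy⟩) else y, ?_⟩
    convert hw.comp (Sum.map id e) using 1 <;>
    · ext (i | i) <;> simp
  choose k hk using hk
  let U : Ultrafilter (Finset V) := Ultrafilter.of atTop
  have hU : ∀ v : V, ∀ᶠ Y in (U : Filter (Finset V)), v ∈ Y := fun v =>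
    Ultrafilter.of_le atTop ((eventually_ge_atTop {v}).mono fun Y hY => hY (by simp))
  let K : SimpleGraph (Germ (U : Filter (Finset V)) V) :=
    { Adj := Germ.LiftRel G.Adj
      symm := ⟨fun x y => Germ.inductionOn₂ x y fun f g hfg =>
        Germ.liftRel_coe.2 ((Germ.liftRel_coe.1 hfg).mono fun _ h => h.symm)⟩
      loopless := ⟨fun x => Germ.inductionOn x fun f hf => by
        obtain ⟨Y, hY⟩ := (Germ.liftRel_coe.1 hf).exists
        exact G.loopless.irrefl _ hY⟩ }
  -- In the ultrapower, `j` is the limit of the maps `k Y` and `d` is the diagonal. Both embed `G`,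
  -- and `j` takes `b` to the diagonal image of `c`.
  let j : V → Germ (U : Filter (Finset V)) V := fun v => ((fun Y => k Y v : Finset V → V) : Germ _ V)
  let d : V → Germ (U : Filter (Finset V)) V := fun v => ((fun _ => v : Finset V → V) : Germ _ V)
  have hjadj : ∀ v w, K.Adj (j v) (j w) ↔ G.Adj v w := by
    intro v w
    have : ∀ᶠ Y in (U : Filter (Finset V)), G.Adj (k Y v) (k Y w) ↔ G.Adj v w := by
      filter_upwards [hU v, hU w] with Y hv hw
      exact ((hk Y).adj_iff (Sum.inr ⟨v, hv⟩) (Sum.inr ⟨w, hw⟩)).symm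
    refine Germ.liftRel_coe.trans ((eventually_congr this).trans ?_)
    simp
  have hjinj : Function.Injective j := by
    intro v w hvw
    obtain ⟨Y, h₁, hv, hw⟩ := ((Germ.coe_eq.1 hvw).and ((hU v).and (hU w))).exists
    exact ((hk Y).eq_iff (Sum.inr ⟨v, hv⟩) (Sum.inr ⟨w, hw⟩)).2 h₁
  have hdadj : ∀ v w, K.Adj (d v) (d w) ↔ G.Adj v w := by
    intro v w
    refine Germ.liftRel_coe.trans ?_
    simp
  have hdinj : Function.Injective d := by
    intro v w hvw
    obtain ⟨Y, h₁⟩ := (Germ.coe_eq.1 hvw).exists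
    exact h₁
  have hbc : ∀ i, j (b i) = d (c i) := by
    intro i
    refine Germ.coe_eq.2 ?_
    filter_upwards [hU (b i)] with Y hY
    exact (((hk Y).eq_iff (Sum.inl i) (Sum.inr ⟨b i, hY⟩)).1 rfl).symm
  -- Restricting to the two images of `G` keeps the graph countable, as membership in the class
  -- demands.
  let T : Set (Germ (U : Filter (Finset V)) V) := Set.range j ∪ Set.range d
  let fj : G ↪g K.induce T := ⟨⟨fun v => ⟨j v, Or.inl ⟨v, rfl⟩⟩,
    fun v w hvw => hjinj (congrArg Subtype.val hvw)⟩, fun {v w} => hjadj v w⟩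
  let fd : G ↪g K.induce T := ⟨⟨fun v => ⟨d v, Or.inr ⟨v, rfl⟩⟩,
    fun v w hvw => hdinj (congrArg Subtype.val hvw)⟩, fun {v w} => hdadj v w⟩
  have hT : MemG 𝒞 (K.induce T) := by
    have := hG.1.1
    refine ⟨((Set.countable_range j).union (Set.countable_range d)).to_subtype, ?_⟩
    rintro C hC ⟨g⟩
    choose r hr using fun n => Quotient.exists_rep (g n).1
    have hr' : ∀ n, ((r n : Finset V → V) : Germ (U : Filter (Finset V)) V) = (g n).1 := hr
    have h₁ : ∀ᶠ Y in (U : Filter (Finset V)), ∀ m n, C.graph.Adj m n → G.Adj (r m Y) (r n Y) := by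
      refine eventually_all.2 fun m => eventually_all.2 fun n => ?_
      by_cases hmn : C.graph.Adj m n
      · have : K.Adj (g m).1 (g n).1 := g.toHom.map_adj hmn
        rw [← hr', ← hr'] at this
        exact (Germ.liftRel_coe.1 this).mono fun _ h _ => h
      · exact Eventually.of_forall fun _ h => absurd h hmn
    have h₂ : ∀ᶠ Y in (U : Filter (Finset V)), ∀ m n, r m Y = r n Y → m = n := by
      refine eventually_all.2 fun m => eventually_all.2 fun n => ?_
      by_cases hmn : m = n
      · exact Eventually.of_forall fun _ _ => hmn
      · have : ∀ᶠ Y in (U : Filter (Finset V)), ¬ r m Y = r n Y := by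
          rw [Ultrafilter.eventually_not]
          intro h
          have := Germ.coe_eq.2 h
          rw [hr', hr'] at this
          exact hmn (g.injective (Subtype.ext this))
        exact this.mono fun _ h h' => absurd h' h
    obtain ⟨Y, hY₁, hY₂⟩ := (h₁.and h₂).exists
    exact hG.1.2 C hC ⟨⟨⟨fun n => r n Y, fun {m n} => hY₁ m n⟩, fun m n => hY₂ m n⟩⟩
  refine hG.reflect hT fj hP ?_
  have : fj ∘ b = fd ∘ c := funext fun i => Subtype.ext (hbc i)
  rw [this]
  exact hP.map_embedding fd hc

/-- Substituting the formulas for the intermediate tuple `z` is not enough: another of the finitely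
many candidate tuples `t` may make `P` hold of infinitely many vertices. Maximality of existential
types gives, for each such `t`, an existential condition true of `z` over the parameters and false
of `t`. Conjoining these leaves a finite union of finite sets. -/
theorem MemE.acl_acl_subset {𝒞 : Set FinGraph} {V : Type u} {G : SimpleGraph V}
    (hG : MemE 𝒞 G) (X : Set V) : acl G (acl G X) ⊆ acl G X := by
  classical
  intro y hy
  obtain ⟨n, z, P, hP, hz, hfin, hy⟩ := exists_exPred_of_mem_acl hy
  choose l a R hR ha hRfin hRz using fun i => exists_exPred_of_mem_acl (hz i)
  let A : (Σ i, Fin (l i)) → V := fun s => a s.1 s.2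
  let Z : Set (Fin n → V) := {t | ∀ i, R i V G (fun o => o.elim (t i) (a i))}
  have hZ : Z.Finite := Set.Finite.pi' hRfin
  obtain ⟨m, ⟨em⟩⟩ := @Finite.exists_equiv_fin _ hfin.to_subtype
  -- The number `m` counts the solutions over `z`, so having `m + 1` solutions is an existential
  -- condition that fails at `z` but holds at every `t` with infinitely many.
  have hΘ : ExPred (fun (W : Type u) H (v : (Σ i, Fin (l i)) ⊕ Fin n → W) =>
      ∃ w : Fin (m + 1) → W, Function.Injective w ∧
        ∀ k, P W H (fun o => o.elim (w k) (v ∘ Sum.inr))) := by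
    refine .exists_family (P := fun W H (v : ((Σ i, Fin (l i)) ⊕ Fin n) ⊕ Fin (m + 1) → W) =>
      Function.Injective (v ∘ Sum.inr) ∧
        ∀ k, P W H (fun o => o.elim (v (Sum.inr k)) ((v ∘ Sum.inl) ∘ Sum.inr)))
      (.and (.of_pattern fun W H v W' H' v' h hv i j hij => hv ((h.eq_iff _ _).2 hij))
        (.forall_finite fun k => ?_))
    have := hP.comp (fun o => o.elim (Sum.inr k) (Sum.inl ∘ Sum.inr) :
      Option (Fin n) → ((Σ i, Fin (l i)) ⊕ Fin n) ⊕ Fin (m + 1))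
    convert this using 5
    funext o
    cases o <;> rfl
  have hQ : ∀ t : Z, ∃ Q : ∀ V : Type u, SimpleGraph V → ((Σ i, Fin (l i)) ⊕ Fin n → V) → Prop,
      ExPred Q ∧ Q V G (Sum.elim A z) ∧
        (Q V G (Sum.elim A t.1) → {y | P V G (fun o => o.elim y t.1)}.Finite) := by
    intro t
    by_cases ht : {y | P V G (fun o => o.elim y t.1)}.Finite
    · exact ⟨fun _ _ _ => True, .of_pattern fun _ _ _ _ _ _ _ _ => trivial, trivial, fun _ => ht⟩
    by_contra! hcon
    have hzΘ := hG.exPred_of_forall_imp (b := Sum.elim A z) (c := Sum.elim A t.1)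
      (fun Q hQ hQz => (hcon Q hQ hQz).1) hΘ
      ⟨fun k => (Set.Infinite.natEmbedding _ ht k : V),
        fun i j hij => Fin.val_injective
          ((Set.Infinite.natEmbedding _ ht).injective (Subtype.ext hij)),
        fun k => (Set.Infinite.natEmbedding _ ht k).2⟩
    obtain ⟨w, hw, hwP⟩ := hzΘ
    have hinj : Function.Injective fun k => em ⟨w k, hwP k⟩ := fun i j hij =>
      hw (congrArg Subtype.val (em.injective hij))
    have := Fintype.card_le_of_injective _ hinj
    simp at this
  choose Q hQe hQz hQfin using hQ
  obtain ⟨N, ⟨eN⟩⟩ := @Finite.exists_equiv_fin _ hZ.to_subtype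
  refine mem_acl_of_exPred (a := A) (P := fun W H v => ∃ t : Fin n → W,
    (∀ i, R i W H (fun o => o.elim (t i) fun k => v (some ⟨i, k⟩))) ∧
    (∀ s : Fin N, Q (eN.symm s) W H (Sum.elim (v ∘ some) t)) ∧
    P W H (fun o => o.elim (v none) t)) ?_ (fun s => ha s.1 s.2) ?_ ?_
  · refine .exists_family (P := fun W H (v : Option (Σ i, Fin (l i)) ⊕ Fin n → W) =>
      (∀ i, R i W H (fun o => o.elim (v (Sum.inr i)) fun k => v (Sum.inl (some ⟨i, k⟩)))) ∧
      (∀ s : Fin N, Q (eN.symm s) W H (Sum.elim ((v ∘ Sum.inl) ∘ some) (v ∘ Sum.inr))) ∧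
      P W H (fun o => o.elim (v (Sum.inl none)) (v ∘ Sum.inr)))
      (.and (.forall_finite fun i => ?_) (.and (.forall_finite fun s => ?_) ?_))
    · have := (hR i).comp (fun o => o.elim (Sum.inr i) fun k => Sum.inl (some ⟨i, k⟩) :
        Option (Fin (l i)) → Option (Σ i, Fin (l i)) ⊕ Fin n)
      convert this using 5
      funext o
      cases o <;> rfl
    · have := (hQe (eN.symm s)).comp (Sum.elim (fun x => Sum.inl (some x)) Sum.inr :
        (Σ i, Fin (l i)) ⊕ Fin n → Option (Σ i, Fin (l i)) ⊕ Fin n)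
      convert this using 5
      funext o
      cases o <;> rfl
    · have := hP.comp (fun o => o.elim (Sum.inl none) Sum.inr :
        Option (Fin n) → Option (Σ i, Fin (l i)) ⊕ Fin n)
      convert this using 5
      funext o
      cases o <;> rfl
  · have hZ' : {t | t ∈ Z ∧ {y | P V G (fun o => o.elim y t)}.Finite}.Finite :=
      hZ.subset fun t ht => ht.1
    refine (hZ'.biUnion fun t ht => ht.2).subset ?_
    rintro x ⟨t, htR, htQ, hx⟩
    have htZ : t ∈ Z := htR
    refine Set.mem_biUnion (show t ∈ {t | t ∈ Z ∧ _} from ⟨htZ, hQfin ⟨t, htZ⟩ ?_⟩) hx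
    have := htQ (eN ⟨t, htZ⟩)
    rwa [Equiv.symm_apply_apply] at this
  · exact ⟨z, hRz, fun s => hQz _, hy⟩

theorem exists_eq_singleton_of_isoPair {𝒞 : Set FinGraph} {V : Type u} {G : SimpleGraph V}
    {A : Set V} {H : G.Subgraph} {p : GraphPair} (hp : p ∈ inducedBranchPairs 𝒞)
    (h : IsoPair A H p) : ∃ x, A = {x} := by
  obtain ⟨C, -, a, B, -, -, haB, e, he⟩ := hp
  obtain ⟨hA, e', he'⟩ := h
  have ha : a ∈ B.verts := haB rfl
  refine ⟨e'.symm (e ⟨a, ha⟩), Set.Subset.antisymm (fun y hy => ?_) ?_⟩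
  · have h₁ := (he' ⟨y, hA hy⟩).1 hy
    obtain ⟨b, hb⟩ := e.surjective (e' ⟨y, hA hy⟩)
    rw [← hb, ← he] at h₁
    obtain rfl : b = ⟨a, ha⟩ := Subtype.ext h₁
    rw [hb]
    simp
  · rintro _ rfl
    rw [he', RelIso.apply_symm_apply, ← he]
    rfl

/-- A branch pair has a one-point base, which lies in a single `acl G {a}`. That set is
algebraically closed, so it also contains the closure of the pair. -/
theorem acl_eq_biUnion {𝒞 : Set FinGraph} (hconn : ∀ C ∈ 𝒞, C.graph.Connected)
    (hsolid : ∀ C ∈ 𝒞, Solid C.graph) {V : Type u} {G : SimpleGraph V} (hG : MemE 𝒞 G)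
    (X : Set V) : acl G X = ⋃ a ∈ X, acl G {a} := by
  refine Set.Subset.antisymm ?_ (Set.iUnion₂_subset fun a ha => acl_mono G (by simpa using ha))
  have hX : X ⊆ ⋃ a ∈ X, acl G {a} := fun x hx =>
    Set.mem_biUnion hx (subset_acl G {x} rfl)
  refine (acl_mono G hX).trans (acl_subset_of_clFam_subset hconn hsolid hG ?_)
  refine Set.union_subset subset_rfl ?_
  rintro y ⟨A, H, hA, ⟨p, hp, hiso⟩, hy⟩
  obtain ⟨x, rfl⟩ := exists_eq_singleton_of_isoPair hp hiso
  obtain ⟨a, haX, hxa⟩ := Set.mem_iUnion₂.1 (hA rfl)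
  exact Set.mem_biUnion haX (cl_subset_of_acl_subset hG (hG.acl_acl_subset {a})
    hiso.finite_verts hiso.1 (by simpa using hxa) hy)

end ForbiddenSubgraphs

theorem proposition6 (𝒞 : Set ForbiddenSubgraphs.FinGraph) (hfin : 𝒞.Finite)
    (hconn : ∀ C ∈ 𝒞, C.graph.Connected)
    (hsolid : ∀ C ∈ 𝒞, ForbiddenSubgraphs.Solid C.graph)
    {V : Type u} (G : SimpleGraph V) (hG : ForbiddenSubgraphs.MemE 𝒞 G)
    (hsat : ForbiddenSubgraphs.Saturated 𝒞 G) :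
    ForbiddenSubgraphs.IsBase G (ForbiddenSubgraphs.branchPairs 𝒞) ∧
    ForbiddenSubgraphs.IsBase G (ForbiddenSubgraphs.inducedBranchPairs 𝒞) ∧
    ∀ X : Set V, ForbiddenSubgraphs.acl G X = ⋃ a ∈ X, ForbiddenSubgraphs.acl G {a} :=
  ⟨ForbiddenSubgraphs.isBase_of_inducedBranchPairs_subset hconn hsolid hG
      fun _ ⟨C, hC, a, H, hH, _, hiso⟩ => ⟨C, hC, a, H, hH, hiso⟩,
    ForbiddenSubgraphs.isBase_of_inducedBranchPairs_subset hconn hsolid hG subset_rfl,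
    ForbiddenSubgraphs.acl_eq_biUnion hconn hsolid hG⟩
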